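/- **Lemma 4.6 (Discrete coercivity).** Let $\Omega\subset\mathbb R^3$ be open, bounded and contractible. For matrix fields $\sigma:\Omega\to\mathbb R^{3\times3}$ let $(\nabla\cdot\sigma)_i=\sum_j\partial_j\sigma_{ij}$ (weak divergence), $(S\sigma)_i=\sigma_{i-1,i+1}-\sigma_{i+1,i-1}$ (indices modulo 3), and let $(\cdot,\cdot)$, $\|\cdot\|$ be the $L^2(\Omega)$ inner product and norm. *Material.* Let $A_\sigma,\tilde A_\omega$ be fields of linear maps $\mathbb R^{3\times 3}\to\mathbb R^{3\times 3}$ on $\Omega$, acting pointwise on $L^2$ matrix fields, pointwise symmetric positive definite, with $(A_\sigma\sigma,\sigma)\ge A_\sigma^-\|\sigma\|^2$, $(A_\sigma\sigma,\tau)\le A_\sigma^+\|\sigma\|\|\tau\|$, and likewise $(\tilde A_\omega\omega,\omega)\ge A_\omega^-\|\omega\|^2$, $(\tilde A_\omega\omega,\rho)\le A_\omega^+\|\omega\|\|\rho\|$, for all $L^2$ matrix fields, where $A_\sigma^-,A_\omega^->0$ and $A_\sigma^+,A_\omega^+<\infty$. Let $\Theta_H$ be a non-overlapping partitioning of $\Omega$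 and let $\ell$ be continuous on $\Omega$ and affine on each cell of $\Theta_H$, with $0\le\ell\le1$ and $|\nabla\ell|\le C_\ell$ almost everywhere. *Spaces.* Let $\Omega_h$ be a simplicial tessellation of $\Omega$ that resolves $\Theta_H$ (each simplex lies in one cell). For $k\ge0$ let $P_{-k}(\Omega_h)$ be the functions that are polynomials of degree at most $k$ on each simplex, $BDM_{k}=P_{-k}(\Omega_h)^3\cap H(\nabla\cdot)$ and $RT_k=(P_{-k}(\Omega_h)^3\oplus\hat P_{-k}(\Omega_h)\,x)\cap H(\nabla\cdot)$, with $\hat P_{-k}$ the piecewise homogeneous polynomials of degree $k$. Put $$X^{p}_{h,k}=BDM_{k+1}^3\times W_k^3,\quad W_k\in\{BDM_{k+1},RT_k\},\qquad X^{u}_{h,k}=P_{-k}(\Omega_h)^3\times P_{-k}(\Omega_h)^3,$$ where the third powers in $X^p_{h,k}$ mean that the rows of the matrix fields lie in the given space. Let $H_\ell\mathcal M$ be the space of pairs $p=(\sigma,\omega)$ of $L^2$ matrix fields with $\nabla\cdot\sigma\in L^2$ and $\nabla\cdot(\ell\omega)\in L^2$, with $$\|p\|_{H_\ell\mathcal M}^2=\|\sigma\|^2+\|\nabla\cdot\sigma\|^2+\|\omega\|^2+\|\nabla\cdot(\ell\omega)\|^2,$$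 and let $(\tilde{\mathcal A}p,p)=(A_\sigma\sigma,\sigma)+(\tilde A_\omega\omega,\omega)$ and $\mathcal S_\ell p=(-\nabla\cdot\sigma,\;S\sigma-\nabla\cdot(\ell\omega))$. *Claim.* $X^p_{h,k}\subset H_\ell\mathcal M$ and $X^u_{h,k}\subset L^2(\Omega)^3\times L^2(\Omega)^3$, and there is a constant $C>0$ depending only on $k$ and $C_\ell$ (in particular not on $\ell$ itself, on the mesh, on $\Omega$, or on the material tensors) such that every $p\in X^p_{h,k}$ with $(\mathcal S_\ell p,u)=0$ for all $u\in X^u_{h,k}$ satisfies $$(\tilde{\mathcal A}p,p)\;\ge\;C\,\min(A_\sigma^-,A_\omega^-)\,\|p\|_{H_\ell\mathcal M}^2 .$$ -/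

import Mathlib

open MeasureTheory Set TopologicalSpace
open scoped Distributions

noncomputable section

namespace Cosserat

/-- Three-dimensional Euclidean space. -/
abbrev R3 : Type := EuclideanSpace ℝ (Fin 3)

/-- Real 3 × 3 matrices. -/
abbrev Mat : Type := Matrix (Fin 3) (Fin 3) ℝ

/-! ### Square integrable fields and weak divergences -/

/-- Square integrable vector fields `L²𝕍` on `Ω`. -/
def L2V (Ω : Set R3) : Set (R3 → Fin 3 → ℝ) :=
  {v | ∀ i, MemLp (fun x => v x i) 2 (volume.restrict Ω)}

/-- Square integrable matrix fields `L²𝕄` on `Ω`. -/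
def L2M (Ω : Set R3) : Set (R3 → Mat) :=
  {σ | ∀ i j, MemLp (fun x => σ x i j) 2 (volume.restrict Ω)}

/-- The `L²` inner product of vector fields. -/
def innerV (Ω : Set R3) (u v : R3 → Fin 3 → ℝ) : ℝ :=
  ∫ x in Ω, ∑ i, u x i * v x i

/-- The `L²` inner product of matrix fields, `∫ σ : τ`. -/
def innerM (Ω : Set R3) (σ τ : R3 → Mat) : ℝ :=
  ∫ x in Ω, ∑ i, ∑ j, σ x i j * τ x i j

/-- The partial derivative `∂φ/∂x_j`. -/
def partialDeriv (j : Fin 3) (φ : R3 → ℝ) (x : R3) : ℝ :=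
  fderiv ℝ φ x (EuclideanSpace.single j 1)

/-- `d` is a weak divergence of the vector field `v` on `Ω`. -/
def IsWeakDiv (Ω : Opens R3) (v : R3 → Fin 3 → ℝ) (d : R3 → ℝ) : Prop :=
  ∀ φ : 𝓓(Ω, ℝ),
    ∫ x in (Ω : Set R3), ∑ j, v x j * partialDeriv j φ x = - ∫ x in (Ω : Set R3), d x * φ x

/-- The space `H(∇·; Ω)` of square integrable vector fields with square integrable weak
divergence. -/
def HDiv (Ω : Opens R3) : Set (R3 → Fin 3 → ℝ) :=
  {v | v ∈ L2V Ω ∧ ∃ d : R3 → ℝ, MemLp d 2 (volume.restrict (Ω : Set R3)) ∧ IsWeakDiv Ω v d}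

open scoped Classical in
/-- The weak divergence of a vector field in `H(∇·; Ω)`; it is determined up to equality almost
everywhere in `Ω`. (Outside `H(∇·; Ω)` the value is `0` by convention.) -/
def weakDiv (Ω : Opens R3) (v : R3 → Fin 3 → ℝ) : R3 → ℝ :=
  if h : ∃ d : R3 → ℝ, MemLp d 2 (volume.restrict (Ω : Set R3)) ∧ IsWeakDiv Ω v d
  then h.choose else 0

/-- The space `H(∇·; 𝕄)` of matrix fields all of whose rows are in `H(∇·; Ω)`. -/
def HDivM (Ω : Opens R3) : Set (R3 → Mat) :=
  {σ | ∀ i, (fun x => σ x i) ∈ HDiv Ω}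

/-- The row-wise weak divergence `(∇·σ)_i = ∑_j ∂σ_ij/∂x_j` of a matrix field. -/
def divM (Ω : Opens R3) (σ : R3 → Mat) : R3 → Fin 3 → ℝ :=
  fun x i => weakDiv Ω (fun y => σ y i) x

/-- The product `ℓ ω` of a scalar field and a matrix field. -/
def scale (ℓ : R3 → ℝ) (ω : R3 → Mat) : R3 → Mat := fun x => ℓ x • ω x

/-- The weighted space `H(∇·ℓ; 𝕄)`. -/
def HDivWeighted (Ω : Opens R3) (ℓ : R3 → ℝ) : Set (R3 → Mat) :=
  {ω | ω ∈ L2M Ω ∧ scale ℓ ω ∈ HDivM Ω}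

/-- The space `H_ℓ𝓜 = H(∇·; 𝕄) × H(∇·ℓ; 𝕄)`. -/
def HlM (Ω : Opens R3) (ℓ : R3 → ℝ) : Set ((R3 → Mat) × (R3 → Mat)) :=
  HDivM Ω ×ˢ HDivWeighted Ω ℓ

/-- The square of the norm of `H_ℓ𝓜`:
`‖(σ, ω)‖² = ‖σ‖² + ‖∇·σ‖² + ‖ω‖² + ‖∇·(ℓω)‖²`. -/
def normSqHlM (Ω : Opens R3) (ℓ : R3 → ℝ) (p : (R3 → Mat) × (R3 → Mat)) : ℝ :=
  (innerM Ω p.1 p.1 + innerV Ω (divM Ω p.1) (divM Ω p.1)) +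
  (innerM Ω p.2 p.2 + innerV Ω (divM Ω (scale ℓ p.2)) (divM Ω (scale ℓ p.2)))

/-! ### Material tensors and the operators of the scaled Cosserat system -/

/-- The asymmetry operator `(Sσ)_i = σ_{i-1,i+1} - σ_{i+1,i-1}`, indices modulo 3. -/
def asym (σ : Mat) : Fin 3 → ℝ := fun i => σ (i - 1) (i + 1) - σ (i + 1) (i - 1)

/-- A field of four-tensors, acting pointwise on matrix fields. -/
abbrev FourTensorField : Type := R3 → (Mat →ₗ[ℝ] Mat)

/-- The matrix field `Aσ`. -/
def FourTensorField.app (A : FourTensorField) (σ : R3 → Mat) : R3 → Mat := fun x => A x (σ x)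

/-- `A` is a material tensor on `Ω` with lower bound `lo` and upper bound `hi`: it acts on `L²𝕄`,
is pointwise symmetric positive definite, and is uniformly bounded from below and above. -/
structure IsMaterialTensor (Ω : Set R3) (A : FourTensorField) (lo hi : ℝ) : Prop where
  mapsTo : ∀ σ ∈ L2M Ω, A.app σ ∈ L2M Ω
  pointwise_symm : ∀ᵐ x ∂volume.restrict Ω, ∀ m n : Mat,
    ∑ i, ∑ j, A x m i j * n i j = ∑ i, ∑ j, A x n i j * m i j
  pointwise_pos : ∀ᵐ x ∂volume.restrict Ω, ∀ m : Mat, m ≠ 0 → 0 < ∑ i, ∑ j, A x m i j * m i j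
  symm : ∀ σ ∈ L2M Ω, ∀ τ ∈ L2M Ω, innerM Ω (A.app σ) τ = innerM Ω (A.app τ) σ
  lo_pos : 0 < lo
  lower : ∀ σ ∈ L2M Ω, lo * innerM Ω σ σ ≤ innerM Ω (A.app σ) σ
  upper : ∀ σ ∈ L2M Ω, ∀ τ ∈ L2M Ω,
    innerM Ω (A.app σ) τ ≤ hi * (√(innerM Ω σ σ) * √(innerM Ω τ τ))

/-- The bilinear form `(𝒜̃ p, r) = (A_σ σ, τ) + (Ã_ω ω, ρ)` for `p = (σ, ω)`, `r = (τ, ρ)`. -/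
def formA (Ω : Set R3) (Aσ Aω : FourTensorField) (p r : (R3 → Mat) × (R3 → Mat)) : ℝ :=
  innerM Ω (Aσ.app p.1) r.1 + innerM Ω (Aω.app p.2) r.2

/-- The operator `S_ℓ (σ, ω) = (-∇·σ, Sσ - ∇·(ℓω))`. -/
def opS (Ω : Opens R3) (ℓ : R3 → ℝ) (p : (R3 → Mat) × (R3 → Mat)) :
    (R3 → Fin 3 → ℝ) × (R3 → Fin 3 → ℝ) :=
  (fun x => - divM Ω p.1 x, fun x => asym (p.1 x) - divM Ω (scale ℓ p.2) x)

/-- The bilinear form `(S_ℓ p, u)` for `u = (u, r)`. -/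
def formS (Ω : Opens R3) (ℓ : R3 → ℝ) (p : (R3 → Mat) × (R3 → Mat))
    (u : (R3 → Fin 3 → ℝ) × (R3 → Fin 3 → ℝ)) : ℝ :=
  innerV Ω (opS Ω ℓ p).1 u.1 + innerV Ω (opS Ω ℓ p).2 u.2

/-! ### Partitions, meshes and piecewise polynomials -/

/-- `Θ` is a non-overlapping partitioning of `Ω` into open cells. -/
structure IsPartition (Ω : Set R3) (Θ : Set (Set R3)) : Prop where
  isOpen : ∀ T ∈ Θ, IsOpen T
  subset : ∀ T ∈ Θ, T ⊆ Ω
  disjoint : Θ.PairwiseDisjoint id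
  ae_cover : ∀ᵐ x ∂volume.restrict Ω, x ∈ ⋃₀ Θ

/-- A (finite, geometrically conforming) simplicial tessellation of `Ω`: a simplicial complex all
of whose faces are faces of tetrahedra, with open tetrahedra inside `Ω`, and filling the closure
of `Ω`. -/
structure SimplicialMesh (Ω : Set R3) extends Geometry.SimplicialComplex ℝ R3 where
  finite_faces : faces.Finite
  pure : ∀ s ∈ faces, ∃ t ∈ faces, s ⊆ t ∧ t.card = 4
  interior_subset : ∀ t ∈ faces, t.card = 4 → interior (convexHull ℝ (t : Set R3)) ⊆ Ω
  space_eq : (⋃ t ∈ faces, convexHull ℝ (t : Set R3)) = closure Ω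

/-- The open 3-simplices of a mesh. -/
def SimplicialMesh.cells {Ω : Set R3} (M : SimplicialMesh Ω) : Set (Set R3) :=
  {T | ∃ t ∈ M.faces, t.card = 4 ∧ T = interior (convexHull ℝ (t : Set R3))}

/-- The mesh `M` resolves the partitioning `Θ`. -/
def SimplicialMesh.Resolves {Ω : Set R3} (M : SimplicialMesh Ω) (Θ : Set (Set R3)) : Prop :=
  ∀ T ∈ M.cells, ∃ U ∈ Θ, T ⊆ U

/-- `P_{-k}(𝒯)`: scalar functions which on each cell of `𝒯` are (almost everywhere equal to) a
polynomial of total degree at most `k`. -/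
def brokenPoly (k : ℕ) (𝒯 : Set (Set R3)) : Set (R3 → ℝ) :=
  {f | ∀ T ∈ 𝒯, ∃ p : MvPolynomial (Fin 3) ℝ, p.totalDegree ≤ k ∧
    ∀ᵐ x ∂volume.restrict T, f x = MvPolynomial.eval (fun i => x i) p}

/-- `P_k(𝒯)`: the functions of `P_{-k}(𝒯)` that are continuous on `Ω`. -/
def contPoly (Ω : Set R3) (k : ℕ) (𝒯 : Set (Set R3)) : Set (R3 → ℝ) :=
  {f | f ∈ brokenPoly k 𝒯 ∧ ContinuousOn f Ω}

/-- `P_{-k}(𝒯)³`. -/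
def brokenPolyV (k : ℕ) (𝒯 : Set (Set R3)) : Set (R3 → Fin 3 → ℝ) :=
  {v | ∀ i, (fun x => v x i) ∈ brokenPoly k 𝒯}

/-- The Brezzi-Douglas-Marini space `BDM_k = P_{-k}³ ∩ H(∇·)`. -/
def BDM {Ω : Opens R3} (k : ℕ) (M : SimplicialMesh (Ω : Set R3)) : Set (R3 → Fin 3 → ℝ) :=
  brokenPolyV k M.cells ∩ HDiv Ω

/-- The Raviart-Thomas space `RT_k = (P_{-k}³ ⊕ P̂_{-k} x) ∩ H(∇·)`, where on each simplex `P̂_{-k}`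
consists of the homogeneous polynomials of degree `k`. -/
def RT {Ω : Opens R3} (k : ℕ) (M : SimplicialMesh (Ω : Set R3)) : Set (R3 → Fin 3 → ℝ) :=
  {v | ∀ T ∈ M.cells, ∃ (p : Fin 3 → MvPolynomial (Fin 3) ℝ) (q : MvPolynomial (Fin 3) ℝ),
    (∀ i, (p i).totalDegree ≤ k) ∧ q.IsHomogeneous k ∧
    ∀ᵐ x ∂volume.restrict T, ∀ i,
      v x i = MvPolynomial.eval (fun i => x i) (p i) +
        MvPolynomial.eval (fun i => x i) q * x i} ∩ HDiv Ω

/-- `W³`: the matrix fields with rows in `W`. -/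
def rows (W : Set (R3 → Fin 3 → ℝ)) : Set (R3 → Mat) := {σ | ∀ i, (fun x => σ x i) ∈ W}

/-- The stress space `BDM_{k+1}³ × W³`. -/
def Xp {Ω : Opens R3} (k : ℕ) (M : SimplicialMesh (Ω : Set R3)) (W : Set (R3 → Fin 3 → ℝ)) :
    Set ((R3 → Mat) × (R3 → Mat)) :=
  rows (BDM (k + 1) M) ×ˢ rows W

/-- The displacement-rotation space `P_{-k}³ × P_{-k}³`. -/
def Xu {Ω : Set R3} (k : ℕ) (M : SimplicialMesh Ω) :
    Set ((R3 → Fin 3 → ℝ) × (R3 → Fin 3 → ℝ)) :=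
  brokenPolyV k M.cells ×ˢ brokenPolyV k M.cells

/-- The discrete kernel of `S_ℓ`: those `p ∈ X^p` with `(S_ℓ p, u) = 0` for all `u ∈ X^u`. -/
def discreteKernel {Ω : Opens R3} (ℓ : R3 → ℝ) (k : ℕ) (M : SimplicialMesh (Ω : Set R3))
    (W : Set (R3 → Fin 3 → ℝ)) : Set ((R3 → Mat) × (R3 → Mat)) :=
  {p | p ∈ Xp k M W ∧ ∀ u ∈ Xu k M, formS Ω ℓ p u = 0}

/-- The length-scale function: continuous and piecewise linear on `Θ`, with values in `[0, 1]` and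
gradient bounded by `Cl` almost everywhere. -/
structure IsLengthScale (Ω : Set R3) (Θ : Set (Set R3)) (ℓ : R3 → ℝ) (Cl : ℝ) : Prop where
  mem : ℓ ∈ contPoly Ω 1 Θ
  bounds : ∀ᵐ x ∂volume.restrict Ω, 0 ≤ ℓ x ∧ ℓ x ≤ 1
  gradient_le : ∀ᵐ x ∂volume.restrict Ω, ‖gradient ℓ x‖ ≤ Cl

end Cosserat

end

noncomputable section

namespace Cosserat

open Filter Topology Metric
open scoped NNReal ContDiff Convolution Pointwise

/-! Both divergences in the norm have to be bounded by `‖σ‖² + ‖ω‖²`; the lower bounds of the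
material tensors do the rest. The divergence of `σ` is itself a broken polynomial of degree at most
`k`, so it may be used as a test function and vanishes (`innerV_divM_eq_zero`).

The divergence of `ℓω` is harder, because it has degree `k + 1` and is not an admissible test
function. On a cell `T` the length scale is an affine function `l`, and row `i` of the divergence is
`l q + β`, where `q` is the divergence of that row of `ω` and `β` is the derivative of `l` along the
row. Now `q` has degree at most `k`, and testing with `q` cut off to `T` gives `∫ l q² = ∫ (s - β)
q`, where `s` is component `i` of `Sσ`. This controls only a weighted norm of `q`, and `l` may
vanish on part of the boundary or be arbitrarily small. The remedy is `exists_simplex_bound`: with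
`m` the largest vertex value of `l`, `m ∫ q² ≤ C ∫ l q²`, where `C` depends on `k` alone. Indeed `l`
dominates `m` times the barycentric coordinate of the maximal vertex, and on the reference simplex
the norm weighted by that coordinate is equivalent to the plain one on polynomials of degree at most
`k`. Young's inequality then yields `∫ (l q)² ≤ C² ∫ (s - β)²` without dividing by `m`
(`setIntegral_mul_sq_le`). Since `β` is bounded by `Cl` times the row of `ω`, summing over rows and
cells gives the estimate.

That `ℓω` has a square integrable divergence at all is the product rule `isWeakDiv_mul`. It tests
the divergence of `ω` with `ℓφ`, which is only Lipschitz; mollification makes such test functions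
legitimate (`IsWeakDiv.integral_lipschitz`). -/

/-- A function with a uniform pointwise Lipschitz bound on a normed space is Lipschitz. -/
theorem lipschitzWith_of_forall_eventually {E : Type*} [NormedAddCommGroup E] [NormedSpace ℝ E]
    {f : E → ℝ} {L : ℝ≥0} (h : ∀ x, ∀ᶠ z in 𝓝 x, |f z - f x| ≤ L * ‖z - x‖) :
    LipschitzWith L f := by
  have hf : Continuous f := by
    rw [continuous_iff_continuousAt]
    intro x
    rw [ContinuousAt, tendsto_iff_norm_sub_tendsto_zero]
    refine squeeze_zero' (Eventually.of_forall fun _ => norm_nonneg _) (h x) ?_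
    have : Continuous fun z : E => (L : ℝ) * ‖z - x‖ := by fun_prop
    simpa using this.tendsto x
  refine LipschitzWith.of_dist_le_mul fun y x => ?_
  rw [dist_eq_norm, dist_eq_norm]
  -- The slack `ε` makes the comparison slope strictly larger than `L * ‖y - x‖`, as the mean value
  -- inequality along the segment demands.
  refine le_of_forall_pos_le_add fun ε hε => ?_
  have hline : Continuous fun t : ℝ => x + t • (y - x) := by fun_prop
  have key := image_norm_le_of_liminf_right_slope_norm_lt_deriv_boundary (a := 0) (b := 1)
    (f := fun t : ℝ => f (x + t • (y - x)) - f x) (f' := fun _ => L * ‖y - x‖)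
    (B := fun t => (L * ‖y - x‖ + ε) * t) (B' := fun _ => L * ‖y - x‖ + ε)
    (by fun_prop) ?_ (by simp) (by fun_prop)
    (fun t _ => by simpa using ((hasDerivAt_id t).const_mul (L * ‖y - x‖ + ε)).hasDerivWithinAt)
    (fun t _ _ => by linarith)
  · simpa using key (right_mem_Icc.2 zero_le_one)
  · intro t _ r hr
    refine Eventually.frequently ?_
    have h1 := (hline.tendsto t).eventually (h (x + t • (y - x)))
    filter_upwards [nhdsWithin_le_nhds h1, self_mem_nhdsWithin] with z hz htz
    have htz : 0 < z - t := sub_pos.2 htz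
    refine lt_of_le_of_lt ?_ hr
    have e : x + z • (y - x) - (x + t • (y - x)) = (z - t) • (y - x) := by module
    rw [e, norm_smul, Real.norm_eq_abs, abs_of_pos htz] at hz
    rw [slope_def_field, div_le_iff₀ htz]
    have := norm_sub_norm_le (f (x + z • (y - x)) - f x) (f (x + t • (y - x)) - f x)
    rw [sub_sub_sub_cancel_right] at this
    simp only [Function.comp, Real.norm_eq_abs] at this ⊢
    linarith

/-! ### Mollification and Lipschitz test functions -/

section Mollify

variable {E : Type*} [NormedAddCommGroup E] [NormedSpace ℝ E] [FiniteDimensional ℝ E]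
  [MeasurableSpace E] (μ : Measure E) {φ : ContDiffBump (0 : E)} {ψ : E → ℝ}

/-- The convolution of `ψ` with a normalized bump function. -/
def mollify (φ : ContDiffBump (0 : E)) (ψ : E → ℝ) : E → ℝ :=
  φ.normed μ ⋆[ContinuousLinearMap.lsmul ℝ ℝ, μ] ψ

theorem mollify_apply (x : E) : mollify μ φ ψ x = ∫ t, φ.normed μ t * ψ (x - t) ∂μ := rfl

variable [BorelSpace E] [μ.IsAddHaarMeasure]

theorem contDiff_mollify (hψ : Continuous ψ) : ContDiff ℝ ∞ (mollify μ φ ψ) :=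
  φ.hasCompactSupport_normed.contDiff_convolution_left _ φ.contDiff_normed hψ.locallyIntegrable

theorem support_mollify_subset :
    Function.support (mollify μ φ ψ) ⊆ cthickening φ.rOut (tsupport ψ) := by
  refine (support_convolution_subset _).trans ?_
  rw [φ.support_normed_eq]
  rintro _ ⟨a, ha, b, hb, rfl⟩
  refine mem_cthickening_of_dist_le _ b _ _ (subset_tsupport _ hb) ?_
  simpa [dist_eq_norm] using (mem_ball.1 ha).le

theorem tsupport_mollify_subset :
    tsupport (mollify μ φ ψ) ⊆ cthickening φ.rOut (tsupport ψ) :=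
  closure_minimal (support_mollify_subset μ) isClosed_cthickening

/-- The bump has integral one, so an increment of the mollification minus `a` is an average of
shifted increments of `ψ` minus `a`, and a bound uniform in the shift survives averaging. With `a =
0` it bounds the gradients uniformly; with small `c` it gives their convergence. -/
theorem norm_fderiv_mollify_sub_le (hψ : Continuous ψ) {x : E} {a : E →L[ℝ] ℝ} {c : ℝ}
    (hc : 0 ≤ c) (h : ∀ᶠ z in 𝓝 x, ∀ t ∈ ball (0 : E) φ.rOut,
      |ψ (z - t) - ψ (x - t) - a (z - x)| ≤ c * ‖z - x‖) :
    ‖fderiv ℝ (mollify μ φ ψ) x - a‖ ≤ c := by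
  have hd : HasFDerivAt (mollify μ φ ψ) (fderiv ℝ (mollify μ φ ψ) x) x :=
    (((contDiff_mollify μ hψ).differentiable (by simp)) x).hasFDerivAt
  refine (hd.sub a.hasFDerivAt).le_of_lip' hc ?_
  filter_upwards [h] with z hz
  have hint : ∀ y, Integrable (fun t => φ.normed μ t * ψ (y - t)) μ := fun y =>
    (φ.continuous_normed.mul (by fun_prop)).integrable_of_hasCompactSupport
      φ.hasCompactSupport_normed.mul_right
  have e : mollify μ φ ψ z - a z - (mollify μ φ ψ x - a x)
      = ∫ t, φ.normed μ t * (ψ (z - t) - ψ (x - t) - a (z - x)) ∂μ := by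
    simp only [mul_sub]
    rw [integral_sub (f := fun t => φ.normed μ t * ψ (z - t) - φ.normed μ t * ψ (x - t))
      ((hint z).sub (hint x)) (φ.integrable_normed.mul_const _),
      integral_sub (hint z) (hint x), integral_mul_const, φ.integral_normed, mollify_apply,
      mollify_apply, map_sub]
    ring
  simp only [Pi.sub_apply]
  rw [e]
  calc ‖∫ t, φ.normed μ t * (ψ (z - t) - ψ (x - t) - a (z - x)) ∂μ‖
      ≤ ∫ t, φ.normed μ t * (c * ‖z - x‖) ∂μ := by
        refine norm_integral_le_of_norm_le (φ.integrable_normed.mul_const _)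
          (Eventually.of_forall fun t => ?_)
        rw [norm_mul, Real.norm_eq_abs, abs_of_nonneg (φ.nonneg_normed t)]
        by_cases ht : t ∈ ball (0 : E) φ.rOut
        · exact mul_le_mul_of_nonneg_left (hz t ht) (φ.nonneg_normed t)
        · have : φ.normed μ t = 0 := by
            rwa [← φ.support_normed_eq (μ := μ), Function.notMem_support] at ht
          simp [this]
    _ = c * ‖z - x‖ := by rw [integral_mul_const, φ.integral_normed, one_mul]

/-- Strict differentiability is what controls increments between the shifted points `z - t` and `x -
t`; differentiability at `x` alone would cover only `t = 0`. -/
theorem tendsto_fderiv_mollify {ι : Type*} {l : Filter ι} {φ : ι → ContDiffBump (0 : E)}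
    (hφ : Tendsto (fun i => (φ i).rOut) l (𝓝 0)) (hψ : Continuous ψ) {x : E} {a : E →L[ℝ] ℝ}
    (h : HasStrictFDerivAt ψ a x) :
    Tendsto (fun i => fderiv ℝ (mollify μ (φ i) ψ) x) l (𝓝 a) := by
  rw [Metric.tendsto_nhds]
  intro ε hε
  have h1 := h.isLittleO.def (half_pos hε)
  obtain ⟨δ, hδ, hball⟩ := Metric.eventually_nhds_iff_ball.1 h1
  filter_upwards [hφ.eventually (gt_mem_nhds (half_pos hδ))] with i hi
  rw [dist_eq_norm]
  refine (norm_fderiv_mollify_sub_le μ hψ (half_pos hε).le ?_).trans_lt (half_lt_self hε)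
  filter_upwards [ball_mem_nhds x (half_pos hδ)] with z hz t ht
  have ht' : ‖t‖ < (φ i).rOut := by simpa using ht
  have hz' : ‖z - x‖ < δ / 2 := by simpa [dist_eq_norm] using hz
  have := hball (z - t, x - t) (by
    rw [mem_ball, Prod.dist_eq, max_lt_iff, dist_eq_norm, dist_eq_norm]
    constructor
    · calc ‖z - t - x‖ = ‖(z - x) - t‖ := by congr 1; abel
        _ ≤ ‖z - x‖ + ‖t‖ := norm_sub_le _ _
        _ < δ := by linarith
    · calc ‖x - t - x‖ = ‖t‖ := by rw [sub_sub_cancel_left, norm_neg]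
        _ < δ := by linarith)
  simpa [sub_sub_sub_cancel_right] using this

end Mollify

theorem isFiniteMeasure_restrict {Ω : Set R3} (hb : Bornology.IsBounded Ω) :
    IsFiniteMeasure (volume.restrict Ω) :=
  ⟨by rw [Measure.restrict_apply_univ]; exact hb.measure_lt_top⟩

theorem memLp_two_mul_bounded {α : Type*} [MeasurableSpace α] {μ : Measure α} {f g : α → ℝ}
    (hf : MemLp f 2 μ) (hg : AEStronglyMeasurable g μ) {c : ℝ} (hc : ∀ᵐ x ∂μ, |g x| ≤ c) :
    MemLp (fun x => g x * f x) 2 μ := by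
  have : MemLp (fun x => c * f x) 2 μ := hf.const_mul c
  refine this.of_le (hg.mul hf.aestronglyMeasurable) ?_
  filter_upwards [hc] with x hx
  rw [norm_mul, norm_mul]
  exact mul_le_mul_of_nonneg_right (hx.trans (le_abs_self c)) (norm_nonneg _)

/-- The defining identity of the weak divergence extends to compactly supported Lipschitz functions
that are strictly differentiable almost everywhere. -/
theorem IsWeakDiv.integral_lipschitz {Ω : Opens R3} (hb : Bornology.IsBounded (Ω : Set R3))
    {v : R3 → Fin 3 → ℝ} {d : R3 → ℝ} (hv : v ∈ L2V Ω)
    (hd : MemLp d 2 (volume.restrict (Ω : Set R3))) (h : IsWeakDiv Ω v d)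
    {ψ : R3 → ℝ} {L : ℝ≥0} (hψ : LipschitzWith L ψ) (hc : HasCompactSupport ψ)
    (hs : tsupport ψ ⊆ Ω) {G : R3 → R3 →L[ℝ] ℝ}
    (hG : ∀ᵐ x ∂volume.restrict (Ω : Set R3), HasStrictFDerivAt ψ (G x) x) :
    ∫ x in (Ω : Set R3), ∑ j, v x j * G x (EuclideanSpace.single j 1) =
      - ∫ x in (Ω : Set R3), d x * ψ x := by
  -- On a bounded domain square integrable fields are integrable, which supplies the dominating
  -- functions below.
  have := isFiniteMeasure_restrict hb
  obtain ⟨δ, hδ, hδΩ⟩ := hc.isCompact.exists_cthickening_subset_open Ω.isOpen hs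
  -- The radii are at most `δ`, so all mollifications are supported in one compact thickening inside
  -- `Ω` and are genuine test functions.
  let φ : ℕ → ContDiffBump (0 : R3) := fun n =>
    ⟨δ / (n + 1) / 2, δ / (n + 1), by positivity, half_lt_self (by positivity)⟩
  have hrφ : ∀ n, (φ n).rOut = δ / (n + 1) := fun _ => rfl
  have hφ : Tendsto (fun n => (φ n).rOut) atTop (𝓝 0) := by
    simp only [hrφ]
    simpa [div_eq_mul_inv] using (tendsto_one_div_add_atTop_nhds_zero_nat (𝕜 := ℝ)).const_mul δ
  have hsub : ∀ n, tsupport (mollify volume (φ n) ψ) ⊆ cthickening δ (tsupport ψ) := fun n =>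
    (tsupport_mollify_subset volume).trans (cthickening_mono (by
      rw [hrφ]; exact div_le_self hδ.le (by linarith [(Nat.cast_nonneg n : (0 : ℝ) ≤ n)])) _)
  let Ψ : ℕ → 𝓓(Ω, ℝ) := fun n =>
    ⟨mollify volume (φ n) ψ, contDiff_mollify volume hψ.continuous,
      hc.isCompact.cthickening.of_isClosed_subset (isClosed_tsupport _) (hsub n),
      (hsub n).trans hδΩ⟩
  have hΨ : ∀ n, (Ψ n : R3 → ℝ) = mollify volume (φ n) ψ := fun _ => rfl
  have hfd : ∀ n x, ‖fderiv ℝ (Ψ n) x‖ ≤ L := by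
    intro n x
    have := norm_fderiv_mollify_sub_le volume (φ := φ n) hψ.continuous (x := x) (a := 0)
      L.coe_nonneg (Eventually.of_forall fun z t _ => by
        simpa [dist_eq_norm] using hψ.dist_le_mul (z - t) (x - t))
    simpa [hΨ] using this
  have hval : ∀ n x, |Ψ n x - ψ x| ≤ L * (δ / (n + 1)) := by
    intro n x
    have := (φ n).dist_normed_convolution_le (μ := volume) (g := ψ) (x₀ := x)
      (ε := L * (δ / (n + 1))) hψ.continuous.aestronglyMeasurable (fun y hy =>
        (hψ.dist_le_mul y x).trans (mul_le_mul_of_nonneg_left (mem_ball.1 hy).le L.coe_nonneg))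
    simpa [Real.dist_eq, hΨ, mollify] using this
  have hfd1 : ∀ n j x, |partialDeriv j (Ψ n) x| ≤ L := fun n j x =>
    ((fderiv ℝ (Ψ n) x).le_opNorm _).trans (by simpa using hfd n x)
  obtain ⟨C, hC⟩ := hψ.continuous.bounded_above_of_compact_support hc
  have lim1 : Tendsto (fun n => ∫ x in (Ω : Set R3), ∑ j, v x j * partialDeriv j (Ψ n) x) atTop
      (𝓝 (∫ x in (Ω : Set R3), ∑ j, v x j * G x (EuclideanSpace.single j 1))) := by
    refine tendsto_integral_of_dominated_convergence (fun x => ∑ j, |v x j| * L) ?_ ?_ ?_ ?_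
    · intro n
      refine Finset.aestronglyMeasurable_fun_sum _ fun j _ => ?_
      refine (hv j).aestronglyMeasurable.mul (Continuous.aestronglyMeasurable ?_)
      exact ((Ψ n).contDiff.continuous_fderiv (by simp)).clm_apply continuous_const
    · exact integrable_finsetSum _ fun j _ =>
        (((hv j).integrable (by norm_num)).abs).mul_const _
    · intro n
      refine Eventually.of_forall fun x => ?_
      refine (norm_sum_le _ _).trans (Finset.sum_le_sum fun j _ => ?_)
      rw [norm_mul]
      exact mul_le_mul_of_nonneg_left (hfd1 n j x) (abs_nonneg _)
    · filter_upwards [hG] with x hx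
      refine tendsto_finsetSum _ fun j _ => Tendsto.const_mul _ ?_
      exact ((ContinuousLinearMap.apply ℝ ℝ (EuclideanSpace.single j 1)).continuous.tendsto _).comp
        (tendsto_fderiv_mollify volume hφ hψ.continuous hx)
  have lim2 : Tendsto (fun n => - ∫ x in (Ω : Set R3), d x * Ψ n x) atTop
      (𝓝 (- ∫ x in (Ω : Set R3), d x * ψ x)) := by
    refine Tendsto.neg ?_
    refine tendsto_integral_of_dominated_convergence (fun x => |d x| * (C + L * δ)) ?_ ?_ ?_ ?_
    · exact fun n => hd.aestronglyMeasurable.mul (Ψ n).continuous.aestronglyMeasurable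
    · exact ((hd.integrable (by norm_num)).abs).mul_const _
    · intro n
      refine Eventually.of_forall fun x => ?_
      rw [norm_mul]
      refine mul_le_mul_of_nonneg_left ?_ (abs_nonneg _)
      have h1 : (δ / (n + 1)) ≤ δ :=
        div_le_self hδ.le (by linarith [(Nat.cast_nonneg n : (0 : ℝ) ≤ n)])
      have h2 := mul_le_mul_of_nonneg_left h1 L.coe_nonneg
      have h3 := hC x
      have h4 := hval n x
      rw [Real.norm_eq_abs] at h3 ⊢
      have h5 := abs_sub_abs_le_abs_sub (Ψ n x) (ψ x)
      linarith
    · refine Eventually.of_forall fun x => Tendsto.const_mul _ ?_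
      rw [tendsto_iff_norm_sub_tendsto_zero]
      refine squeeze_zero (fun _ => norm_nonneg _) (fun n => hval n x) ?_
      simpa [hrφ] using hφ.const_mul (L : ℝ)
  refine tendsto_nhds_unique lim1 (lim2.congr fun n => (h (Ψ n)).symm)

/-! ### Polynomial functions -/

/-- The polynomial function on `R3` of a polynomial in three variables. -/
def evalR3 (p : MvPolynomial (Fin 3) ℝ) (x : R3) : ℝ := MvPolynomial.eval (fun i => x i) p

@[simp] theorem evalR3_C (a : ℝ) (x : R3) : evalR3 (.C a) x = a := MvPolynomial.eval_C _

@[simp] theorem evalR3_X (i : Fin 3) (x : R3) : evalR3 (.X i) x = x i := MvPolynomial.eval_X _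

@[simp] theorem evalR3_add (p q : MvPolynomial (Fin 3) ℝ) (x : R3) :
    evalR3 (p + q) x = evalR3 p x + evalR3 q x := map_add _ _ _

@[simp] theorem evalR3_mul (p q : MvPolynomial (Fin 3) ℝ) (x : R3) :
    evalR3 (p * q) x = evalR3 p x * evalR3 q x := map_mul _ _ _

theorem evalR3_sum {ι : Type*} (s : Finset ι) (p : ι → MvPolynomial (Fin 3) ℝ) (x : R3) :
    evalR3 (∑ i ∈ s, p i) x = ∑ i ∈ s, evalR3 (p i) x := map_sum _ _ _

theorem contDiff_evalR3 (p : MvPolynomial (Fin 3) ℝ) : ContDiff ℝ ∞ (evalR3 p) := by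
  induction p using MvPolynomial.induction_on with
  | C a =>
    have e : evalR3 (.C a) = fun _ => a := funext fun x => evalR3_C a x
    rw [e]
    exact contDiff_const
  | add p q hp hq =>
    have e : evalR3 (p + q) = fun x => evalR3 p x + evalR3 q x := funext fun x => evalR3_add p q x
    rw [e]
    exact hp.add hq
  | mul_X p i hp =>
    have hi : ContDiff ℝ ∞ fun x : R3 => x i := (EuclideanSpace.proj i : R3 →L[ℝ] ℝ).contDiff
    have e : evalR3 (p * .X i) = fun x => evalR3 p x * x i := funext fun x => by simp
    rw [e]
    exact hp.mul hi

theorem continuous_evalR3 (p : MvPolynomial (Fin 3) ℝ) : Continuous (evalR3 p) :=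
  (contDiff_evalR3 p).continuous

theorem partialDeriv_evalR3 (j : Fin 3) (p : MvPolynomial (Fin 3) ℝ) (x : R3) :
    partialDeriv j (evalR3 p) x = evalR3 (MvPolynomial.pderiv j p) x := by
  have hd : ∀ q, DifferentiableAt ℝ (evalR3 q) x := fun q =>
    ((contDiff_evalR3 q).differentiable (by simp)) x
  unfold partialDeriv
  induction p using MvPolynomial.induction_on with
  | C a =>
    have : evalR3 (.C a) = fun _ => a := funext fun x => evalR3_C a x
    simp [this, evalR3]
  | add p q hp hq =>
    have : evalR3 (p + q) = fun x => evalR3 p x + evalR3 q x := funext fun x => evalR3_add p q x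
    rw [this, fderiv_fun_add (hd p) (hd q)]
    simp [hp, hq]
  | mul_X p i hp =>
    have hi : HasFDerivAt (fun x : R3 => x i) (EuclideanSpace.proj i : R3 →L[ℝ] ℝ) x :=
      (EuclideanSpace.proj i : R3 →L[ℝ] ℝ).hasFDerivAt
    have : evalR3 (p * .X i) = fun x => evalR3 p x * x i := funext fun x => by simp
    rw [this, fderiv_fun_mul (hd p) hi.differentiableAt, hi.fderiv]
    simp only [add_apply, smul_apply, hp,
      Derivation.leibniz, smul_eq_mul, evalR3_add, evalR3_mul, evalR3_X, MvPolynomial.pderiv_X]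
    rw [mul_comm (x i)]
    by_cases hij : i = j
    · subst hij
      simp [evalR3]
    · simp [hij, evalR3]

theorem totalDegree_pderiv_le {σ R : Type*} [CommSemiring R] (j : σ) {p : MvPolynomial σ R}
    {k : ℕ} (hp : p.totalDegree ≤ k + 1) : (MvPolynomial.pderiv j p).totalDegree ≤ k := by
  classical
  rw [p.as_sum, map_sum]
  refine MvPolynomial.totalDegree_finsetSum_le fun s hs => ?_
  rw [MvPolynomial.pderiv_monomial]
  -- If the variable is absent, the coefficient `s j` kills the term; otherwise the truncated
  -- subtraction in the exponent is a true one.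
  by_cases h : s j = 0
  · simp [h]
  refine (MvPolynomial.totalDegree_monomial_le _ _).trans ?_
  have h1 : s.sum (fun _ => id) ≤ k + 1 := (MvPolynomial.le_totalDegree hs).trans hp
  have h2 : s - Finsupp.single j 1 + Finsupp.single j 1 = s :=
    tsub_add_cancel_of_le (by simpa [Nat.one_le_iff_ne_zero] using h)
  have h3 : (s - Finsupp.single j 1).sum (fun _ => id) + 1 = s.sum (fun _ => id) := by
    conv_rhs => rw [← h2]
    rw [Finsupp.sum_add_index' (fun _ => rfl) (fun _ _ _ => rfl)]
    simp
  omega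

/-- Affine substitutions do not raise the degree, so pulling back to the reference simplex stays
within one finite-dimensional space. -/
theorem totalDegree_bind₁_le {σ τ R : Type*} [CommSemiring R] {f : σ → MvPolynomial τ R}
    (hf : ∀ i, (f i).totalDegree ≤ 1) {p : MvPolynomial σ R} {k : ℕ} (hp : p.totalDegree ≤ k) :
    (MvPolynomial.bind₁ f p).totalDegree ≤ k := by
  rw [p.as_sum, map_sum]
  refine MvPolynomial.totalDegree_finsetSum_le fun s hs => ?_
  rw [MvPolynomial.bind₁_monomial]
  refine (MvPolynomial.totalDegree_mul _ _).trans ?_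
  rw [MvPolynomial.totalDegree_C, zero_add]
  refine (MvPolynomial.totalDegree_finsetProd _ _).trans ?_
  refine le_trans (Finset.sum_le_sum fun i _ => (MvPolynomial.totalDegree_pow _ _).trans
    (Nat.mul_le_mul_left (s i) (hf i))) ?_
  simpa [Finsupp.sum] using (MvPolynomial.le_totalDegree hs).trans hp

/-- A polynomial of degree at most one is an affine function. -/
theorem evalR3_eq_affine {p : MvPolynomial (Fin 3) ℝ} (hp : p.totalDegree ≤ 1) (x : R3) :
    evalR3 p x = evalR3 p 0 + ∑ j, evalR3 (MvPolynomial.pderiv j p) 0 * x j := by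
  -- The partial derivatives have degree zero, so the derivative is constant and subtracting it
  -- leaves a constant.
  have hc : ∀ y, fderiv ℝ (evalR3 p) y = fderiv ℝ (evalR3 p) 0 := by
    intro y
    refine ContinuousLinearMap.coe_injective
      ((EuclideanSpace.basisFun (Fin 3) ℝ).toBasis.ext fun j => ?_)
    simp only [OrthonormalBasis.coe_toBasis, EuclideanSpace.basisFun_apply]
    have h0 := totalDegree_pderiv_le (k := 0) j hp
    rw [Nat.le_zero, MvPolynomial.totalDegree_eq_zero_iff_eq_C] at h0
    have e := fun z => partialDeriv_evalR3 j p z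
    rw [h0] at e
    exact (e y).trans (by rw [evalR3_C]; exact ((e 0).trans (evalR3_C _ _)).symm)
  have hd : Differentiable ℝ (evalR3 p) := (contDiff_evalR3 p).differentiable (by simp)
  have key : (fun x => evalR3 p x - fderiv ℝ (evalR3 p) 0 x) x
      = (fun x => evalR3 p x - fderiv ℝ (evalR3 p) 0 x) 0 :=
    is_const_of_fderiv_eq_zero (𝕜 := ℝ) (hd.sub (ContinuousLinearMap.differentiable _))
      (fun y => by
        change fderiv ℝ (fun x => evalR3 p x - fderiv ℝ (evalR3 p) 0 x) y = 0
        rw [fderiv_fun_sub (hd y) (ContinuousLinearMap.differentiableAt _),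
          ContinuousLinearMap.fderiv, hc, sub_self]) _ _
  have hx : x = ∑ j, x j • EuclideanSpace.single j (1 : ℝ) := by
    simpa using ((EuclideanSpace.basisFun (Fin 3) ℝ).sum_repr x).symm
  have hlin : fderiv ℝ (evalR3 p) 0 x = ∑ j, evalR3 (MvPolynomial.pderiv j p) 0 * x j := by
    conv_lhs => rw [hx]
    rw [map_sum]
    refine Finset.sum_congr rfl fun j _ => ?_
    rw [map_smul, smul_eq_mul, mul_comm, ← partialDeriv_evalR3]
    rfl
  simp only [map_zero, sub_zero] at key
  rw [← hlin, ← key]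
  ring

theorem evalR3_pderiv_const {p : MvPolynomial (Fin 3) ℝ} (hp : p.totalDegree ≤ 1) (j : Fin 3)
    (x y : R3) : evalR3 (MvPolynomial.pderiv j p) x = evalR3 (MvPolynomial.pderiv j p) y := by
  have h0 := totalDegree_pderiv_le (k := 0) j hp
  rw [Nat.le_zero, MvPolynomial.totalDegree_eq_zero_iff_eq_C] at h0
  rw [h0, evalR3_C, evalR3_C]

theorem evalR3_sub_of_affine {p : MvPolynomial (Fin 3) ℝ} (hp : p.totalDegree ≤ 1) (x y : R3) :
    evalR3 p x - evalR3 p y = fderiv ℝ (evalR3 p) 0 (x - y) := by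
  have h : ∀ z, evalR3 p z = evalR3 p 0 + fderiv ℝ (evalR3 p) 0 z := by
    intro z
    rw [evalR3_eq_affine hp z]
    have hz : z = ∑ j, z j • EuclideanSpace.single j (1 : ℝ) := by
      simpa using ((EuclideanSpace.basisFun (Fin 3) ℝ).sum_repr z).symm
    conv_rhs => rw [hz]
    rw [map_sum]
    congr 1
    refine Finset.sum_congr rfl fun j _ => ?_
    rw [map_smul, smul_eq_mul, mul_comm, ← partialDeriv_evalR3]
    rfl
  rw [h x, h y, map_sub]
  ring

theorem memLp_evalR3 (p : MvPolynomial (Fin 3) ℝ) {T : Set R3} (hT : Bornology.IsBounded T)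
    (hm : MeasurableSet T) : MemLp (evalR3 p) 2 (volume.restrict T) := by
  have := isFiniteMeasure_restrict hT
  obtain ⟨C, hC⟩ := (hT.isCompact_closure).exists_bound_of_continuousOn
    (continuous_evalR3 p).continuousOn
  exact MemLp.of_bound (continuous_evalR3 p).aestronglyMeasurable C
    ((ae_restrict_iff' hm).2 (Eventually.of_forall fun x hx => hC x (subset_closure hx)))

/-- On an open set where a vector field is polynomial, its weak divergence is the classical one. -/
theorem IsWeakDiv.ae_eq_of_polynomial {Ω : Opens R3} {v : R3 → Fin 3 → ℝ} {d : R3 → ℝ}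
    (h : IsWeakDiv Ω v d) (hd : MemLp d 2 (volume.restrict (Ω : Set R3)))
    {T : Set R3} (hT : IsOpen T) (hTΩ : T ⊆ Ω) (P : Fin 3 → MvPolynomial (Fin 3) ℝ)
    (hP : ∀ᵐ x ∂volume.restrict T, ∀ j, v x j = evalR3 (P j) x) :
    ∀ᵐ x ∂volume.restrict T, d x = evalR3 (∑ j, MvPolynomial.pderiv j (P j)) x := by
  set D := evalR3 (∑ j, MvPolynomial.pderiv j (P j)) with hD
  have hdT : LocallyIntegrableOn d T volume :=
    (locallyIntegrableOn_of_locallyIntegrable_restrict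
      (hd.locallyIntegrable (by norm_num))).mono_set hTΩ
  rw [ae_restrict_iff' hT.measurableSet]
  have hloc : LocallyIntegrableOn (fun x => d x - D x) T volume :=
    hdT.sub ((continuous_evalR3 _).locallyIntegrable.locallyIntegrableOn T)
  -- Fundamental lemma of the calculus of variations on `T`: test functions supported in `T` are
  -- test functions on `Ω`, and for them the polynomial can be integrated by parts classically.
  have key := hT.ae_eq_zero_of_integral_contDiff_smul_eq_zero (μ := volume) hloc ?_
  · filter_upwards [key] with x hx hxT
    exact sub_eq_zero.1 (hx hxT)
  intro g hg hgc hgT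
  let Φ : 𝓓(Ω, ℝ) := ⟨g, hg, hgc, hgT.trans hTΩ⟩
  have hΦ : (Φ : R3 → ℝ) = g := rfl
  have hgz : ∀ x ∉ T, g x = 0 := fun x hx =>
    image_eq_zero_of_notMem_tsupport fun h => hx (hgT h)
  have hgz' : ∀ j, ∀ x ∉ T, partialDeriv j g x = 0 := fun j x hx => by
    have : fderiv ℝ g x = 0 :=
      image_eq_zero_of_notMem_tsupport fun h => hx (hgT (tsupport_fderiv_subset ℝ h))
    simp [partialDeriv, this]
  have hgcont : ∀ j, Continuous (partialDeriv j g) := fun j =>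
    (hg.continuous_fderiv (by simp)).clm_apply continuous_const
  have hgpc : ∀ j, HasCompactSupport (partialDeriv j g) := fun j =>
    (hgc.fderiv ℝ).comp_left (g := fun L : R3 →L[ℝ] ℝ => L (EuclideanSpace.single j 1)) rfl
  have h0 := h Φ
  rw [hΦ] at h0
  have l1 : ∫ x in (Ω : Set R3), ∑ j, v x j * partialDeriv j g x
      = ∫ x, ∑ j, evalR3 (P j) x * partialDeriv j g x := by
    rw [setIntegral_eq_of_subset_of_forall_sdiff_eq_zero Ω.isOpen.measurableSet hTΩ
      (fun x hx => by simp [hgz' _ x hx.2]),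
      ← setIntegral_eq_integral_of_forall_compl_eq_zero (s := T)
      (f := fun x => ∑ j, evalR3 (P j) x * partialDeriv j g x) (fun x hx => by simp [hgz' _ x hx])]
    refine integral_congr_ae ?_
    filter_upwards [hP] with x hx
    simp [hx]
  have l2 : ∫ x in (Ω : Set R3), d x * g x = ∫ x, d x * g x :=
    setIntegral_eq_integral_of_forall_compl_eq_zero
      fun x hx => by simp [hgz x fun h => hx (hTΩ h)]
  have ibp : ∀ j, ∫ x, evalR3 (P j) x * partialDeriv j g x
      = - ∫ x, evalR3 (MvPolynomial.pderiv j (P j)) x * g x := by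
    intro j
    have := integral_mul_fderiv_eq_neg_fderiv_mul_of_integrable (μ := volume)
      (f := evalR3 (P j)) (g := g) (v := EuclideanSpace.single j (1 : ℝ)) ?_ ?_ ?_
      (fun x _ => (contDiff_evalR3 _).differentiable (by simp) x)
      (fun x _ => hg.differentiable (by simp) x)
    · simp only [← partialDeriv_evalR3]
      exact this
    · change Integrable (fun x => partialDeriv j (evalR3 (P j)) x * g x) volume
      simp only [partialDeriv_evalR3]
      exact ((continuous_evalR3 _).mul hg.continuous).integrable_of_hasCompactSupport
        hgc.mul_left
    · exact ((continuous_evalR3 _).mul (hgcont j)).integrable_of_hasCompactSupport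
        (hgpc j).mul_left
    · exact ((continuous_evalR3 _).mul hg.continuous).integrable_of_hasCompactSupport
        hgc.mul_left
  have l3 : ∫ x, ∑ j, evalR3 (P j) x * partialDeriv j g x = - ∫ x, D x * g x := by
    rw [integral_finsetSum (f := fun j x => evalR3 (P j) x * partialDeriv j g x) _
      fun j _ => ((continuous_evalR3 _).mul
        (hgcont j)).integrable_of_hasCompactSupport (hgpc j).mul_left]
    simp only [ibp, Finset.sum_neg_distrib]
    rw [← integral_finsetSum (f := fun j x => evalR3 (MvPolynomial.pderiv j (P j)) x * g x) _
      fun j _ => ((continuous_evalR3 _).mul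
        hg.continuous).integrable_of_hasCompactSupport hgc.mul_left]
    simp only [hD, evalR3_sum, Finset.sum_mul]
  have hDg : Integrable (fun x => D x * g x) volume :=
    ((continuous_evalR3 _).mul hg.continuous).integrable_of_hasCompactSupport hgc.mul_left
  have hdg : Integrable (fun x => d x * g x) volume := by
    have := (hd.locallyIntegrable (by norm_num)).integrable_smul_left_of_hasCompactSupport
      hg.continuous hgc
    refine (integrableOn_iff_integrable_of_support_subset (s := (Ω : Set R3)) ?_).1
      (by simpa [IntegrableOn, mul_comm] using this)
    intro x hx
    by_contra hxΩ
    exact hx (by simp [hgz x fun h => hxΩ (hTΩ h)])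
  have : ∀ x, g x • (d x - D x) = d x * g x - D x * g x := fun x => by
    rw [smul_eq_mul]; ring
  simp only [this]
  rw [integral_sub hdg hDg]
  rw [l1, l2, l3] at h0
  linarith

/-! ### Weighted norm equivalence for polynomials on simplices -/

/-- Two continuous quadratically homogeneous functions on `ℝⁿ`, the second one positive. -/
theorem exists_le_mul_of_homogeneous {n : ℕ} {Q₁ Q₂ : (Fin n → ℝ) → ℝ} (h₁ : Continuous Q₁)
    (h₂ : Continuous Q₂) (hom₁ : ∀ (t : ℝ) c, Q₁ (t • c) = t ^ 2 * Q₁ c)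
    (hom₂ : ∀ (t : ℝ) c, Q₂ (t • c) = t ^ 2 * Q₂ c) (hpos : ∀ c, c ≠ 0 → 0 < Q₂ c) :
    ∃ C : ℝ, 0 < C ∧ ∀ c, Q₁ c ≤ C * Q₂ c := by
  have hcont : ContinuousOn (fun c => Q₁ c / Q₂ c) (sphere 0 1) :=
    h₁.continuousOn.div h₂.continuousOn fun c hc => (hpos c (ne_zero_of_mem_unit_sphere
      (⟨c, hc⟩ : sphere (0 : Fin n → ℝ) 1))).ne'
  obtain ⟨C, hC⟩ := (isCompact_sphere (0 : Fin n → ℝ) 1).exists_bound_of_continuousOn hcont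
  refine ⟨max C 1, by positivity, fun c => ?_⟩
  rcases eq_or_ne c 0 with rfl | hc
  · have e₁ := hom₁ 0 0
    have e₂ := hom₂ 0 0
    simp only [smul_zero] at e₁ e₂
    rw [e₁, e₂]
    simp
  have hn : 0 < ‖c‖ := norm_pos_iff.2 hc
  have hs : ‖c‖⁻¹ • c ∈ sphere (0 : Fin n → ℝ) 1 := by
    simp [norm_smul, hn.ne']
  have h := (le_abs_self _).trans (hC _ hs)
  rw [hom₁, hom₂, mul_div_mul_left _ _ (by positivity), div_le_iff₀ (hpos c hc)] at h
  exact h.trans (mul_le_mul_of_nonneg_right (le_max_left _ _) (hpos c hc).le)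

/-- The open reference simplex. -/
def refSimplex : Set R3 := {x | (∀ i, 0 < x i) ∧ ∑ i, x i < 1}

theorem isOpen_refSimplex : IsOpen refSimplex := by
  have : refSimplex = (⋂ i : Fin 3, {x : R3 | 0 < x i}) ∩ {x : R3 | ∑ i, x i < 1} := by
    ext x; simp [refSimplex]
  rw [this]
  exact (isOpen_iInter_of_finite fun i => isOpen_lt continuous_const (by fun_prop)).inter
    (isOpen_lt (by fun_prop) continuous_const)

theorem refSimplex_subset_closedBall : refSimplex ⊆ closedBall (0 : R3) 1 := by
  intro x hx
  rw [mem_closedBall_zero_iff, EuclideanSpace.norm_eq, ← Real.sqrt_one]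
  refine Real.sqrt_le_sqrt ?_
  have h := hx.1
  have hs := hx.2
  have h1 : ∀ i, x i ≤ 1 := fun i =>
    (Finset.single_le_sum (fun j _ => (h j).le) (Finset.mem_univ i)).trans hs.le
  refine le_trans (Finset.sum_le_sum fun i _ => ?_) hs.le
  rw [Real.norm_eq_abs, sq_abs]
  nlinarith [h i, h1 i]

theorem integrableOn_refSimplex {f : R3 → ℝ} (hf : Continuous f) :
    IntegrableOn f refSimplex volume :=
  (hf.continuousOn.integrableOn_compact (isCompact_closedBall 0 1)).mono_set
    refSimplex_subset_closedBall

theorem eq_zero_of_forall_refSimplex {p : MvPolynomial (Fin 3) ℝ}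
    (h : ∀ x ∈ refSimplex, evalR3 p x = 0) : p = 0 := by
  -- The simplex contains the cube `(0, 1/3)³`, a product of infinite sets, and a polynomial
  -- vanishing on such a product is zero.
  refine MvPolynomial.funext_set (fun _ => Ioo 0 (1 / 3)) (fun _ => Ioo_infinite (by norm_num))
    fun x hx => ?_
  rw [map_zero]
  refine h (WithLp.toLp 2 x) ⟨fun i => (hx i (mem_univ _)).1, ?_⟩
  have := fun i => (hx i (mem_univ _)).2
  simp only [Fin.sum_univ_three]
  linarith [this 0, this 1, this 2]

/-- Equivalence of norms in finite dimension: the weight, the barycentric coordinate of the origin,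
is positive on the open simplex, so the weighted integral is still a positive definite quadratic
form. -/
theorem exists_refSimplex_bound (k : ℕ) : ∃ C : ℝ, 0 < C ∧
    ∀ q : MvPolynomial (Fin 3) ℝ, q.totalDegree ≤ k →
      ∫ x in refSimplex, evalR3 q x ^ 2 ≤
        C * ∫ x in refSimplex, (1 - ∑ i, x i) * evalR3 q x ^ 2 := by
  let V := MvPolynomial.restrictTotalDegree (Fin 3) ℝ k
  let b := Module.finBasis ℝ V
  let F : (Fin (Module.finrank ℝ V) → ℝ) → V := b.equivFun.symm
  have hF : ∀ c x, evalR3 (F c : MvPolynomial (Fin 3) ℝ) x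
      = ∑ i, c i * evalR3 (b i : MvPolynomial (Fin 3) ℝ) x := by
    intro c x
    have : (F c : MvPolynomial (Fin 3) ℝ) = ∑ i, c i • (b i : MvPolynomial (Fin 3) ℝ) := by
      simp [F, Module.Basis.equivFun_symm_apply]
    rw [this, evalR3_sum]
    refine Finset.sum_congr rfl fun i _ => ?_
    rw [MvPolynomial.smul_eq_C_mul, evalR3_mul, evalR3_C]
  have hFs : ∀ (t : ℝ) c x, evalR3 (F (t • c) : MvPolynomial (Fin 3) ℝ) x
      = t * evalR3 (F c : MvPolynomial (Fin 3) ℝ) x := by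
    intro t c x
    simp only [hF, Pi.smul_apply, smul_eq_mul, Finset.mul_sum, mul_assoc]
  -- Continuity of the parametric integral is available over compact sets, so the open simplex is
  -- treated as a measure on the closed unit ball.
  have hrr : (volume.restrict refSimplex).restrict (closedBall (0 : R3) 1)
      = volume.restrict refSimplex := by
    rw [Measure.restrict_restrict isClosed_closedBall.measurableSet,
      inter_eq_right.2 refSimplex_subset_closedBall]
  have hFc : Continuous fun z : (Fin (Module.finrank ℝ V) → ℝ) × R3 =>
      evalR3 (F z.1 : MvPolynomial (Fin 3) ℝ) z.2 := by
    simp only [hF]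
    refine continuous_finsetSum _ fun i _ => ?_
    exact ((continuous_apply i).comp continuous_fst).mul
      ((continuous_evalR3 _).comp continuous_snd)
  have hcont : ∀ w : R3 → ℝ, Continuous w → Continuous fun c =>
      ∫ x in refSimplex, w x * evalR3 (F c : MvPolynomial (Fin 3) ℝ) x ^ 2 := by
    intro w hw
    have := continuous_parametric_integral_of_continuous (μ := volume.restrict refSimplex)
      (f := fun c x => w x * evalR3 (F c : MvPolynomial (Fin 3) ℝ) x ^ 2)
      (by exact (hw.comp continuous_snd).mul (hFc.pow 2)) (isCompact_closedBall (0 : R3) 1)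
    rwa [hrr] at this
  have hhom : ∀ (w : R3 → ℝ) (t : ℝ) c,
      ∫ x in refSimplex, w x * evalR3 (F (t • c) : MvPolynomial (Fin 3) ℝ) x ^ 2
        = t ^ 2 * ∫ x in refSimplex, w x * evalR3 (F c : MvPolynomial (Fin 3) ℝ) x ^ 2 := by
    intro w t c
    rw [← integral_const_mul]
    refine integral_congr_ae (Eventually.of_forall fun x => ?_)
    simp only [hFs]
    ring
  have hwc : Continuous fun x : R3 => 1 - ∑ i, x i := by fun_prop
  obtain ⟨C, hC, h⟩ := exists_le_mul_of_homogeneous (hcont (fun _ => 1) continuous_const)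
    (hcont (fun x => 1 - ∑ i, x i) hwc) (hhom _) (hhom _) (fun c hc => by
      have hint := integrableOn_refSimplex (f := fun x =>
        (1 - ∑ i, x i) * evalR3 (F c : MvPolynomial (Fin 3) ℝ) x ^ 2)
        (hwc.mul ((continuous_evalR3 _).pow 2))
      rw [setIntegral_pos_iff_support_of_nonneg_ae _ hint]
      · have hne : ∃ x ∈ refSimplex, evalR3 (F c : MvPolynomial (Fin 3) ℝ) x ≠ 0 := by
          by_contra! hall
          have h0 : F c = 0 := Subtype.ext (eq_zero_of_forall_refSimplex hall)
          exact hc (b.equivFun.symm.map_eq_zero_iff.1 h0)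
        obtain ⟨x, hx, hqx⟩ := hne
        refine IsOpen.measure_pos _ (IsOpen.inter ?_ isOpen_refSimplex) ⟨x, ?_, hx⟩
        · exact (hwc.mul ((continuous_evalR3 _).pow 2)).isOpen_support
        · exact mul_ne_zero (sub_pos.2 hx.2).ne' (pow_ne_zero 2 hqx)
      · refine (ae_restrict_iff' isOpen_refSimplex.measurableSet).2
          (Eventually.of_forall fun x hx => ?_)
        exact mul_nonneg (sub_pos.2 hx.2).le (sq_nonneg _))
  refine ⟨C, hC, fun q hq => ?_⟩
  have e : F (b.equivFun ⟨q, (MvPolynomial.mem_restrictTotalDegree _ _ _).2 hq⟩)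
      = ⟨q, (MvPolynomial.mem_restrictTotalDegree _ _ _).2 hq⟩ := b.equivFun.symm_apply_apply _
  have := h (b.equivFun ⟨q, (MvPolynomial.mem_restrictTotalDegree _ _ _).2 hq⟩)
  rw [e] at this
  simpa only [one_mul] using this

/-- The affine map from the reference simplex onto the simplex with vertices `v`. -/
def simplexMap (v : Fin 4 → R3) (x : R3) : R3 := v 0 + ∑ i : Fin 3, x i • (v i.succ - v 0)

/-- The interior of a simplex is where all barycentric coordinates are positive; those of
`simplexMap v x` are `1 - ∑ i, x i` and the `x i`. -/
theorem simplexMap_image {v : Fin 4 → R3} (hv : AffineIndependent ℝ v) :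
    simplexMap v '' refSimplex = interior (convexHull ℝ (range v)) := by
  have htop : affineSpan ℝ (range v) = ⊤ :=
    hv.affineSpan_eq_top_iff_card_eq_finrank_add_one.2 (by simp)
  let b : AffineBasis (Fin 4) ℝ R3 := ⟨v, hv, htop⟩
  have hbv : ⇑b = v := rfl
  rw [← hbv, b.interior_convexHull]
  ext y
  constructor
  · rintro ⟨x, hx, rfl⟩ i
    let w : Fin 4 → ℝ := Fin.cons (1 - ∑ i, x i) fun i => x i
    have hw : ∑ i, w i = 1 := by
      simp [w, Fin.sum_univ_succ]
    have e : simplexMap b x = Finset.univ.affineCombination ℝ b w := by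
      rw [Finset.affineCombination_eq_linear_combination _ _ _ hw, Fin.sum_univ_succ]
      simp only [w, Fin.cons_zero, Fin.cons_succ, simplexMap, smul_sub, Finset.sum_sub_distrib,
        ← Finset.sum_smul]
      module
    rw [e, b.coord_apply_combination_of_mem (Finset.mem_univ i) hw]
    refine Fin.cases ?_ (fun j => ?_) i
    · simpa [w] using hx.2
    · simpa [w] using hx.1 j
  · intro hy
    have hs := b.sum_coord_apply_eq_one y
    rw [Fin.sum_univ_succ] at hs
    refine ⟨WithLp.toLp 2 fun i => b.coord i.succ y, ⟨fun i => hy _, ?_⟩, ?_⟩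
    · have := hy 0
      simp only
      linarith
    · have h := b.linear_combination_coord_eq_self y
      rw [Fin.sum_univ_succ] at h
      conv_rhs => rw [← h]
      have h0 : b.coord 0 y = 1 - ∑ i : Fin 3, b.coord i.succ y := by linarith
      simp only [simplexMap, smul_sub, Finset.sum_sub_distrib, ← Finset.sum_smul, h0]
      module

theorem simplexMap_injective {v : Fin 4 → R3} (hv : AffineIndependent ℝ v) :
    Function.Injective (simplexMap v) := by
  intro x y hxy
  have hl := (affineIndependent_iff_linearIndependent_vsub ℝ v 0).1 hv
  have hl' : LinearIndependent ℝ fun i : Fin 3 => v i.succ - v 0 := by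
    refine hl.comp (fun i : Fin 3 => (⟨i.succ, Fin.succ_ne_zero i⟩ : {x : Fin 4 // x ≠ 0}))
      fun i j h => ?_
    simpa using h
  have h := add_left_cancel hxy
  rw [← sub_eq_zero, ← Finset.sum_sub_distrib] at h
  simp only [← sub_smul] at h
  ext i
  exact sub_eq_zero.1 (Fintype.linearIndependent_iff.1 hl' _ h i)

/-- The linear part of `simplexMap`. -/
def simplexMapLin (v : Fin 4 → R3) : R3 →L[ℝ] R3 :=
  ∑ i : Fin 3, (EuclideanSpace.proj i : R3 →L[ℝ] ℝ).smulRight (v i.succ - v 0)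

theorem hasFDerivAt_simplexMap (v : Fin 4 → R3) (x : R3) :
    HasFDerivAt (simplexMap v) (simplexMapLin v) x := by
  have e : simplexMap v = fun y => v 0 + simplexMapLin v y := by
    ext1 y
    simp [simplexMap, simplexMapLin]
  rw [e]
  exact (simplexMapLin v).hasFDerivAt.const_add _

/-- The Jacobian is constant, so it appears equally on both sides of the weighted estimate and
leaves no trace of the shape of the cell. -/
theorem setIntegral_simplex {v : Fin 4 → R3} (hv : AffineIndependent ℝ v) (g : R3 → ℝ) :
    ∫ x in interior (convexHull ℝ (range v)), g x
      = |(simplexMapLin v).det| * ∫ x in refSimplex, g (simplexMap v x) := by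
  rw [← simplexMap_image hv, integral_image_eq_integral_abs_det_fderiv_smul volume
    isOpen_refSimplex.measurableSet (fun x _ => (hasFDerivAt_simplexMap v x).hasFDerivWithinAt)
    (simplexMap_injective hv).injOn, ← integral_const_mul]
  rfl

theorem exists_evalR3_comp_simplexMap (v : Fin 4 → R3) {q : MvPolynomial (Fin 3) ℝ} {k : ℕ}
    (hq : q.totalDegree ≤ k) : ∃ q' : MvPolynomial (Fin 3) ℝ, q'.totalDegree ≤ k ∧
      ∀ x, evalR3 q' x = evalR3 q (simplexMap v x) := by
  let f : Fin 3 → MvPolynomial (Fin 3) ℝ := fun j =>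
    .C (v 0 j) + ∑ i : Fin 3, .C (v i.succ j - v 0 j) * .X i
  refine ⟨MvPolynomial.bind₁ f q, totalDegree_bind₁_le (fun j => ?_) hq, fun x => ?_⟩
  · refine (MvPolynomial.totalDegree_add _ _).trans (max_le (by simp) ?_)
    refine MvPolynomial.totalDegree_finsetSum_le fun i _ => ?_
    refine (MvPolynomial.totalDegree_mul _ _).trans ?_
    rw [MvPolynomial.totalDegree_C, MvPolynomial.totalDegree_X]
  · have hf : ∀ j, evalR3 (f j) x = simplexMap v x j := by
      intro j
      simp only [f, evalR3_add, evalR3_sum, evalR3_mul, evalR3_C, evalR3_X]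
      simp [simplexMap, mul_comm]
    have := MvPolynomial.eval₂Hom_bind₁ (RingHom.id ℝ) (fun i => x i) f q
    refine this.trans ?_
    change MvPolynomial.eval (fun i => evalR3 (f i) x) q = _
    simp only [hf]
    rfl

/-- On a simplex, the `L²` norm of a polynomial is bounded by the norm weighted with a nonnegative
affine function, uniformly in the simplex and the affine function. -/
theorem exists_simplex_bound (k : ℕ) : ∃ C : ℝ, 0 < C ∧
    ∀ v : Fin 4 → R3, AffineIndependent ℝ v →
    ∀ q l : MvPolynomial (Fin 3) ℝ, q.totalDegree ≤ k → l.totalDegree ≤ 1 →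
    (∀ x ∈ interior (convexHull ℝ (range v)), 0 ≤ evalR3 l x) →
    ∃ m : ℝ, 0 ≤ m ∧ (∀ x ∈ interior (convexHull ℝ (range v)), evalR3 l x ≤ m) ∧
      m * ∫ x in interior (convexHull ℝ (range v)), evalR3 q x ^ 2 ≤
        C * ∫ x in interior (convexHull ℝ (range v)), evalR3 l x * evalR3 q x ^ 2 := by
  obtain ⟨C, hC, hbound⟩ := exists_refSimplex_bound k
  refine ⟨C, hC, fun v hv q l hq hl hpos => ?_⟩
  obtain ⟨i₀, hi₀⟩ := Finite.exists_max fun i => evalR3 l (v i)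
  -- The vertices are relabelled so that `l` is largest at vertex `0`, the one carried to by the
  -- origin of the reference simplex.
  set w : Fin 4 → R3 := v ∘ Equiv.swap 0 i₀ with hw
  have hrange : range w = range v := (Equiv.swap 0 i₀).surjective.range_comp v
  have hwi : AffineIndependent ℝ w := (affineIndependent_equiv (Equiv.swap 0 i₀)).2 hv
  have hmax : ∀ i, evalR3 l (w i) ≤ evalR3 l (w 0) := fun i => by
    simpa [hw] using hi₀ (Equiv.swap 0 i₀ i)
  rw [← hrange] at hpos ⊢
  have hne : (interior (convexHull ℝ (range w))).Nonempty := by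
    rw [← simplexMap_image hwi]
    refine Nonempty.image _ ⟨WithLp.toLp 2 fun _ => 1 / 4, fun i => by simp, ?_⟩
    simp only [Fin.sum_univ_three]
    norm_num
  -- Nonnegativity is known only on the open cell; it passes to the vertices by closure.
  have hvert : ∀ i, 0 ≤ evalR3 l (w i) := by
    intro i
    have hmem : w i ∈ closure (interior (convexHull ℝ (range w))) := by
      rw [(convex_convexHull ℝ _).closure_interior_eq_closure_of_nonempty_interior hne]
      exact subset_closure (subset_convexHull ℝ _ (mem_range_self i))
    exact closure_minimal (t := {x | 0 ≤ evalR3 l x}) hpos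
      (isClosed_le continuous_const (continuous_evalR3 l)) hmem
  have hcomb : ∀ x, evalR3 l (simplexMap w x)
      = evalR3 l (w 0) + ∑ i : Fin 3, x i * (evalR3 l (w i.succ) - evalR3 l (w 0)) := by
    intro x
    have h1 := evalR3_sub_of_affine hl (simplexMap w x) (w 0)
    have h2 : simplexMap w x - w 0 = ∑ i : Fin 3, x i • (w i.succ - w 0) := by
      simp [simplexMap]
    rw [h2, map_sum] at h1
    simp only [map_smul, smul_eq_mul, ← evalR3_sub_of_affine hl] at h1
    linarith
  obtain ⟨q', hq', hqe⟩ := exists_evalR3_comp_simplexMap w hq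
  refine ⟨evalR3 l (w 0), hvert 0, ?_, ?_⟩
  · rw [← simplexMap_image hwi]
    rintro _ ⟨x, hx, rfl⟩
    rw [hcomb]
    have : ∑ i : Fin 3, x i * (evalR3 l (w i.succ) - evalR3 l (w 0)) ≤ 0 :=
      Finset.sum_nonpos fun i _ =>
        mul_nonpos_of_nonneg_of_nonpos (hx.1 i).le (sub_nonpos.2 (hmax _))
    linarith
  · rw [setIntegral_simplex hwi, setIntegral_simplex hwi]
    simp only [← hqe]
    -- Discarding the nonnegative values at the other vertices leaves `l ≥ l(w 0) (1 - ∑ i, x i)` in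
    -- reference coordinates.
    have hlow : evalR3 l (w 0) * ∫ x in refSimplex, (1 - ∑ i, x i) * evalR3 q' x ^ 2
        ≤ ∫ x in refSimplex, evalR3 l (simplexMap w x) * evalR3 q' x ^ 2 := by
      rw [← integral_const_mul]
      have hA : Continuous (simplexMap w) := by unfold simplexMap; fun_prop
      refine setIntegral_mono_on ?_ ?_ isOpen_refSimplex.measurableSet fun x hx => ?_
      · exact integrableOn_refSimplex (continuous_const.mul
          ((by fun_prop : Continuous fun x : R3 => 1 - ∑ i, x i).mul
            ((continuous_evalR3 q').pow 2)))
      · exact integrableOn_refSimplex (((continuous_evalR3 l).comp hA).mul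
          ((continuous_evalR3 q').pow 2))
      · rw [← mul_assoc]
        refine mul_le_mul_of_nonneg_right ?_ (sq_nonneg _)
        rw [hcomb]
        have : ∑ i : Fin 3, x i * (0 - evalR3 l (w 0))
            ≤ ∑ i : Fin 3, x i * (evalR3 l (w i.succ) - evalR3 l (w 0)) :=
          Finset.sum_le_sum fun i _ => mul_le_mul_of_nonneg_left
            (sub_le_sub_right (hvert _) _) (hx.1 i).le
        rw [← Finset.sum_mul] at this
        linarith
    have h1 := mul_le_mul_of_nonneg_left (hbound q' hq') (hvert 0)
    have h2 := mul_le_mul_of_nonneg_left hlow hC.le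
    have h3 := mul_le_mul_of_nonneg_left (h1.trans (by linarith : _ ≤ C * ∫ x in refSimplex,
      evalR3 l (simplexMap w x) * evalR3 q' x ^ 2)) (abs_nonneg (simplexMapLin w).det)
    linarith

/-! ### Cells of a simplicial mesh -/

/-- The open simplex with vertices `t`. -/
def openCell (t : Finset R3) : Set R3 := interior (convexHull ℝ (t : Set R3))

theorem isOpen_openCell (t : Finset R3) : IsOpen (openCell t) := isOpen_interior

theorem isBounded_openCell (t : Finset R3) : Bornology.IsBounded (openCell t) :=
  (isBounded_convexHull.2 t.finite_toSet.isBounded).subset interior_subset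

namespace SimplicialMesh

variable {Ω : Set R3} (M : SimplicialMesh Ω)

/-- The tetrahedra of a mesh, given by their vertices. -/
def tets : Finset (Finset R3) := {t ∈ M.finite_faces.toFinset | t.card = 4}

variable {M}

theorem mem_tets {t : Finset R3} : t ∈ M.tets ↔ t ∈ M.faces ∧ t.card = 4 := by
  simp [tets]

theorem mem_cells {T : Set R3} : T ∈ M.cells ↔ ∃ t ∈ M.tets, T = openCell t := by
  simp only [mem_tets, and_assoc]
  rfl

theorem openCell_mem_cells {t : Finset R3} (ht : t ∈ M.tets) : openCell t ∈ M.cells :=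
  mem_cells.2 ⟨t, ht, rfl⟩

theorem openCell_subset {t : Finset R3} (ht : t ∈ M.tets) : openCell t ⊆ Ω :=
  M.interior_subset t (mem_tets.1 ht).1 (mem_tets.1 ht).2

theorem exists_vertices {t : Finset R3} (ht : t ∈ M.tets) :
    ∃ v : Fin 4 → R3, AffineIndependent ℝ v ∧ range v = t := by
  obtain ⟨hf, hc⟩ := mem_tets.1 ht
  let e := (Finset.equivFinOfCardEq hc).symm
  refine ⟨fun i => (e i : R3), (M.indep hf).comp_embedding e.toEmbedding, ?_⟩
  ext x
  constructor
  · rintro ⟨i, rfl⟩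
    exact (e i).2
  · intro hx
    exact ⟨e.symm ⟨x, hx⟩, by simp⟩

theorem openCell_nonempty {t : Finset R3} (ht : t ∈ M.tets) : (openCell t).Nonempty := by
  obtain ⟨v, hv, hr⟩ := exists_vertices ht
  rw [openCell, interior_convexHull_nonempty_iff_affineSpan_eq_top, ← hr]
  exact hv.affineSpan_eq_top_iff_card_eq_finrank_add_one.2 (by simp)

theorem convexHull_subset_closure_openCell {t : Finset R3} (ht : t ∈ M.tets) :
    convexHull ℝ (t : Set R3) ⊆ closure (openCell t) := by
  rw [openCell, (convex_convexHull ℝ _).closure_interior_eq_closure_of_nonempty_interior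
    (openCell_nonempty ht)]
  exact subset_closure

/-- In a simplicial complex the overlap lies in the hull of the common vertices. If the open cells
met, that hull would have interior points, which takes four vertices, so the two simplices would
coincide. -/
theorem disjoint_openCell {s t : Finset R3} (hs : s ∈ M.tets) (ht : t ∈ M.tets) (hst : s ≠ t) :
    Disjoint (openCell s) (openCell t) := by
  classical
  rw [Set.disjoint_iff_inter_eq_empty]
  by_contra hne
  obtain ⟨hsf, hsc⟩ := mem_tets.1 hs
  obtain ⟨htf, htc⟩ := mem_tets.1 ht
  have hsub : openCell s ∩ openCell t ⊆ interior (convexHull ℝ ((s ∩ t : Finset R3) : Set R3)) := by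
    refine interior_maximal ?_ ((isOpen_openCell s).inter (isOpen_openCell t))
    rw [Finset.coe_inter]
    exact (inter_subset_inter _root_.interior_subset _root_.interior_subset).trans
      (M.inter_subset_convexHull hsf htf)
  have htop := (interior_convexHull_nonempty_iff_affineSpan_eq_top).1
    ((nonempty_iff_ne_empty.2 hne).mono hsub)
  have hind : AffineIndependent ℝ ((↑) : (s ∩ t : Finset R3) → R3) :=
    (M.indep hsf).mono (Finset.coe_subset.2 Finset.inter_subset_left)
  have hr : range ((↑) : (s ∩ t : Finset R3) → R3) = ((s ∩ t : Finset R3) : Set R3) :=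
    Subtype.range_coe
  have hcard := hind.affineSpan_eq_top_iff_card_eq_finrank_add_one.1 (by rw [hr]; exact htop)
  simp only [Fintype.card_coe, finrank_euclideanSpace, Fintype.card_fin] at hcard
  have h1 : s ∩ t = s := Finset.eq_of_subset_of_card_le Finset.inter_subset_left (by omega)
  have h2 : s ∩ t = t := Finset.eq_of_subset_of_card_le Finset.inter_subset_right (by omega)
  exact hst (h1.symm.trans h2)

theorem exists_mem_convexHull {x : R3} (hx : x ∈ Ω) :
    ∃ t ∈ M.tets, x ∈ convexHull ℝ (t : Set R3) := by
  have h := subset_closure hx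
  rw [← M.space_eq] at h
  simp only [mem_iUnion] at h
  obtain ⟨s, hs, hxs⟩ := h
  obtain ⟨t, ht, hst, hc⟩ := M.pure s hs
  exact ⟨t, mem_tets.2 ⟨ht, hc⟩, convexHull_mono (Finset.coe_subset.2 hst) hxs⟩

variable (M) in
-- Closed simplices cover `Ω`, and what the open cells miss lies on frontiers of convex sets, which
-- are null.
theorem ae_eq_biUnion : Ω =ᵐ[volume] ⋃ t ∈ M.tets, openCell t := by
  refine (ae_eq_set).2 ⟨?_, ?_⟩
  · have h0 : volume (⋃ t ∈ M.tets, frontier (convexHull ℝ (t : Set R3))) = 0 :=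
      (measure_biUnion_null_iff M.tets.countable_toSet).2 fun t _ =>
        (convex_convexHull ℝ _).addHaar_frontier volume
    refine measure_mono_null ?_ h0
    rintro x ⟨hx, hxn⟩
    obtain ⟨t, ht, hxt⟩ := exists_mem_convexHull hx
    refine mem_biUnion ht ⟨subset_closure hxt, fun hxi => hxn (mem_biUnion ht hxi)⟩
  · have : (⋃ t ∈ M.tets, openCell t) \ Ω = ∅ :=
      sdiff_eq_empty.2 (iUnion₂_subset fun t ht => openCell_subset ht)
    rw [this, measure_empty]

variable (M) in
theorem restrict_eq : volume.restrict Ω = volume.restrict (⋃ t ∈ M.tets, openCell t) :=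
  Measure.restrict_congr_set M.ae_eq_biUnion

variable (M) in
theorem ae_iff (p : R3 → Prop) : (∀ᵐ x ∂volume.restrict Ω, p x) ↔
    ∀ t ∈ M.tets, ∀ᵐ x ∂volume.restrict (openCell t), p x := by
  rw [M.restrict_eq, ae_restrict_biUnion_finset_iff]

theorem setIntegral_eq_sum {f : R3 → ℝ} (hf : IntegrableOn f Ω) :
    ∫ x in Ω, f x = ∑ t ∈ M.tets, ∫ x in openCell t, f x := by
  rw [M.restrict_eq]
  exact integral_biUnion_finset _ (fun t _ => (isOpen_openCell t).measurableSet)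
    (fun s hs t ht hst => disjoint_openCell hs ht hst)
    fun t ht => hf.mono_set (openCell_subset ht)

end SimplicialMesh

open SimplicialMesh

theorem memLp_of_mem_brokenPoly {Ω : Set R3} {M : SimplicialMesh Ω} {k : ℕ} {f : R3 → ℝ}
    (hf : f ∈ brokenPoly k M.cells) : MemLp f 2 (volume.restrict Ω) := by
  classical
  have h : ∀ t, ∃ p : MvPolynomial (Fin 3) ℝ, t ∈ M.tets →
      ∀ᵐ x ∂volume.restrict (openCell t), f x = evalR3 p x := by
    intro t
    by_cases ht : t ∈ M.tets
    · obtain ⟨p, -, hp⟩ := hf _ (openCell_mem_cells ht)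
      exact ⟨p, fun _ => hp⟩
    · exact ⟨0, fun h => absurd h ht⟩
  choose p hp using h
  -- Almost everywhere the function is a finite sum of polynomials cut off to bounded cells;
  -- measurability and integrability are inherited from that sum.
  have hae : (fun x => ∑ t ∈ M.tets, (openCell t).indicator (evalR3 (p t)) x)
      =ᵐ[volume.restrict Ω] f := by
    refine (M.ae_iff _).2 fun t ht => ?_
    filter_upwards [hp t ht, ae_restrict_mem (isOpen_openCell t).measurableSet] with x hx hxt
    rw [Finset.sum_eq_single_of_mem t ht, indicator_of_mem hxt, hx]
    intro s hs hst
    exact indicator_of_notMem (fun hxs => disjoint_left.1 (disjoint_openCell hs ht hst) hxs hxt) _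
  refine (memLp_congr_ae hae).1 (memLp_finsetSum _ fun t ht => ?_)
  rw [memLp_indicator_iff_restrict (isOpen_openCell t).measurableSet,
    Measure.restrict_restrict (isOpen_openCell t).measurableSet,
    inter_eq_left.2 (openCell_subset ht)]
  exact memLp_evalR3 _ (isBounded_openCell t) (isOpen_openCell t).measurableSet

/-! ### The length scale -/

theorem hasStrictFDerivAt_evalR3_of_affine {p : MvPolynomial (Fin 3) ℝ} (hp : p.totalDegree ≤ 1)
    (x : R3) : HasStrictFDerivAt (evalR3 p) (fderiv ℝ (evalR3 p) 0) x := by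
  have e : evalR3 p = fun y => evalR3 p 0 + fderiv ℝ (evalR3 p) 0 y := by
    ext1 y
    have := evalR3_sub_of_affine hp y 0
    rw [sub_zero] at this
    linarith
  have h : HasStrictFDerivAt (fun y => evalR3 p 0 + fderiv ℝ (evalR3 p) 0 y)
      (fderiv ℝ (evalR3 p) 0) x := (fderiv ℝ (evalR3 p) 0).hasStrictFDerivAt.const_add _
  exact h.congr_of_eventuallyEq (Eventually.of_forall fun y => (congrFun e y).symm)

theorem norm_gradient_eq (f : R3 → ℝ) (x : R3) : ‖gradient f x‖ = ‖fderiv ℝ f x‖ :=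
  LinearIsometryEquiv.norm_map _ _

namespace IsLengthScale

variable {Ω : Opens R3} {Θ : Set (Set R3)} {ℓ : R3 → ℝ} {Cl : ℝ}
  {M : SimplicialMesh (Ω : Set R3)}

theorem mem_Icc (h : IsLengthScale Ω Θ ℓ Cl) {x : R3} (hx : x ∈ Ω) : ℓ x ∈ Icc (0 : ℝ) 1 := by
  have hc := h.mem.2
  -- The almost everywhere bounds say that `ℓ` equals its truncation to `[0, 1]`; both are
  -- continuous, so they agree on all of `Ω`.
  have := Measure.eqOn_open_of_ae_eq (μ := volume) (f := ℓ) (g := fun x => max 0 (min 1 (ℓ x)))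
    (by
      filter_upwards [h.bounds] with x hx
      rw [min_eq_right hx.2, max_eq_right hx.1])
    Ω.isOpen hc (continuousOn_const.sup (continuousOn_const.inf hc)) hx
  rw [this]
  exact ⟨le_max_left _ _, max_le zero_le_one (min_le_left _ _)⟩

/-- The affine formula on the open cell extends by continuity to the part of the closed simplex in
`Ω`. This is what later links values of `ℓ` across faces. -/
theorem exists_affine (h : IsLengthScale Ω Θ ℓ Cl) (hM : M.Resolves Θ) {t : Finset R3}
    (ht : t ∈ M.tets) : ∃ l : MvPolynomial (Fin 3) ℝ, l.totalDegree ≤ 1 ∧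
      EqOn ℓ (evalR3 l) (convexHull ℝ (t : Set R3) ∩ Ω) ∧ ‖fderiv ℝ (evalR3 l) 0‖ ≤ Cl := by
  obtain ⟨U, hU, hTU⟩ := hM _ (openCell_mem_cells ht)
  obtain ⟨l, hl, hle⟩ := h.mem.1 U hU
  have hT := isOpen_openCell t
  have heq : EqOn ℓ (evalR3 l) (openCell t) :=
    Measure.eqOn_open_of_ae_eq (μ := volume) (ae_restrict_of_ae_restrict_of_subset hTU hle) hT
      (h.mem.2.mono (openCell_subset ht)) (continuous_evalR3 l).continuousOn
  refine ⟨l, hl, heq.of_subset_closure (h.mem.2.mono inter_subset_right)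
    (continuous_evalR3 l).continuousOn (subset_inter interior_subset (openCell_subset ht))
    (inter_subset_left.trans (convexHull_subset_closure_openCell ht)), ?_⟩
  have hg := ae_restrict_of_ae_restrict_of_subset (openCell_subset ht) h.gradient_le
  -- The cell has positive measure, so the gradient bound holds at some point of it; one point
  -- suffices for an affine function.
  have hne : NeBot (ae (volume.restrict (openCell t))) := by
    rw [ae_neBot, Ne, Measure.restrict_eq_zero]
    exact (hT.measure_pos volume (openCell_nonempty ht)).ne'
  obtain ⟨x, hx, hxt⟩ := (hg.and (ae_restrict_mem hT.measurableSet)).exists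
  rw [norm_gradient_eq, (heq.eventuallyEq_of_mem (hT.mem_nhds hxt)).fderiv_eq,
    (hasStrictFDerivAt_evalR3_of_affine hl x).hasFDerivAt.fderiv] at hx
  exact hx

/-- Inside an open cell `ℓ` coincides with an affine function, and the cells fill `Ω` up to a null
set. -/
theorem hasStrictFDerivAt (h : IsLengthScale Ω Θ ℓ Cl) (hM : M.Resolves Θ) :
    ∀ᵐ x ∂volume.restrict (Ω : Set R3), HasStrictFDerivAt ℓ (fderiv ℝ ℓ x) x := by
  refine (M.ae_iff _).2 fun t ht => ?_
  obtain ⟨l, hl, heq, -⟩ := h.exists_affine hM ht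
  filter_upwards [ae_restrict_mem (isOpen_openCell t).measurableSet] with x hx
  have he : evalR3 l =ᶠ[𝓝 x] ℓ := by
    filter_upwards [(isOpen_openCell t).mem_nhds hx] with y hy
    exact (heq ⟨interior_subset hy, openCell_subset ht hy⟩).symm
  have := (hasStrictFDerivAt_evalR3_of_affine hl x).congr_of_eventuallyEq he
  rwa [this.hasFDerivAt.fderiv]

/-- Near `x` only closed simplices containing `x` occur, since there are finitely many. Hence `z`
and `x` share a simplex, and a single affine piece gives the increment. -/
theorem eventually_abs_sub_le (h : IsLengthScale Ω Θ ℓ Cl) (hM : M.Resolves Θ) {x : R3}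
    (hx : x ∈ Ω) : ∀ᶠ z in 𝓝 x, z ∈ Ω ∧ |ℓ z - ℓ x| ≤ Cl * ‖z - x‖ := by
  have h1 : ∀ᶠ z in 𝓝 x, ∀ t ∈ M.tets, z ∈ convexHull ℝ (t : Set R3) →
      x ∈ convexHull ℝ (t : Set R3) := by
    refine (Finset.eventually_all _).2 fun t _ => ?_
    by_cases hxt : x ∈ convexHull ℝ (t : Set R3)
    · exact Eventually.of_forall fun _ _ => hxt
    · filter_upwards [(t.finite_toSet.isClosed_convexHull ℝ).isOpen_compl.mem_nhds hxt]
        with z hz hzt using absurd hzt hz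
  filter_upwards [h1, Ω.isOpen.mem_nhds hx] with z hz hzΩ
  obtain ⟨t, ht, hzt⟩ := exists_mem_convexHull (M := M) hzΩ
  obtain ⟨l, hl, heq, hn⟩ := h.exists_affine hM ht
  refine ⟨hzΩ, ?_⟩
  rw [heq ⟨hzt, hzΩ⟩, heq ⟨hz t ht hzt, hx⟩, evalR3_sub_of_affine hl]
  exact ((fderiv ℝ (evalR3 l) 0).le_opNorm _).trans
    (mul_le_mul_of_nonneg_right hn (norm_nonneg _))

theorem aestronglyMeasurable (h : IsLengthScale Ω Θ ℓ Cl) :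
    AEStronglyMeasurable ℓ (volume.restrict (Ω : Set R3)) :=
  h.mem.2.aestronglyMeasurable Ω.isOpen.measurableSet

theorem ae_abs_le_one (h : IsLengthScale Ω Θ ℓ Cl) :
    ∀ᵐ x ∂volume.restrict (Ω : Set R3), |ℓ x| ≤ 1 := by
  filter_upwards [h.bounds] with x hx
  rw [abs_of_nonneg hx.1]
  exact hx.2

theorem ae_abs_partialDeriv_le (h : IsLengthScale Ω Θ ℓ Cl) (j : Fin 3) :
    ∀ᵐ x ∂volume.restrict (Ω : Set R3), |partialDeriv j ℓ x| ≤ Cl := by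
  filter_upwards [h.gradient_le] with x hx
  rw [norm_gradient_eq] at hx
  refine ((fderiv ℝ ℓ x).le_opNorm _).trans ?_
  simpa using hx

theorem aestronglyMeasurable_partialDeriv (j : Fin 3) (μ : Measure R3) :
    AEStronglyMeasurable (partialDeriv j ℓ) μ :=
  (measurable_fderiv_apply_const ℝ ℓ _).aestronglyMeasurable

/-- The product with a test function is Lipschitz. -/
theorem exists_lipschitzWith_mul (h : IsLengthScale Ω Θ ℓ Cl) (hM : M.Resolves Θ) (φ : 𝓓(Ω, ℝ)) :
    ∃ L, LipschitzWith L fun x => ℓ x * φ x := by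
  obtain ⟨K, hK⟩ := φ.contDiff.lipschitzWith_of_hasCompactSupport φ.hasCompactSupport (by simp)
  obtain ⟨B, hB⟩ := φ.continuous.bounded_above_of_compact_support φ.hasCompactSupport
  -- Product rule constant: the slope of `ℓ` times the bound of `φ`, plus the bound `1` of `ℓ` times
  -- the Lipschitz constant of `φ`. Off the support of `φ` the product vanishes locally, whatever
  -- `ℓ` is outside `Ω`.
  refine ⟨(|Cl| * |B|).toNNReal + K, lipschitzWith_of_forall_eventually fun x => ?_⟩
  rw [NNReal.coe_add, Real.coe_toNNReal _ (by positivity)]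
  by_cases hx : x ∈ tsupport φ
  · have hxΩ := φ.tsupport_subset hx
    filter_upwards [h.eventually_abs_sub_le hM hxΩ] with z hz
    have e : ℓ z * φ z - ℓ x * φ x = (ℓ z - ℓ x) * φ z + ℓ x * (φ z - φ x) := by ring
    have h1 : |φ z - φ x| ≤ K * ‖z - x‖ := by
      simpa [dist_eq_norm] using hK.dist_le_mul z x
    have h2 : |ℓ x| ≤ 1 := abs_le.2 ⟨by linarith [(h.mem_Icc hxΩ).1], (h.mem_Icc hxΩ).2⟩
    have h3 : |φ z| ≤ |B| := (hB z).trans (le_abs_self B)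
    have h4 : |ℓ z - ℓ x| ≤ |Cl| * ‖z - x‖ :=
      hz.2.trans (mul_le_mul_of_nonneg_right (le_abs_self _) (norm_nonneg _))
    rw [e]
    refine (abs_add_le _ _).trans ?_
    rw [abs_mul, abs_mul]
    have h5 := mul_le_mul h4 h3 (abs_nonneg _) (by positivity)
    have h6 := mul_le_mul h2 h1 (abs_nonneg _) zero_le_one
    linarith
  · have hopen : (tsupport φ)ᶜ ∈ 𝓝 x := (isClosed_tsupport _).isOpen_compl.mem_nhds hx
    filter_upwards [hopen] with z hz
    rw [image_eq_zero_of_notMem_tsupport hz, image_eq_zero_of_notMem_tsupport hx]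
    simp only [mul_zero, sub_zero, abs_zero]
    positivity

theorem memLp_mul (h : IsLengthScale Ω Θ ℓ Cl) {f : R3 → ℝ}
    (hf : MemLp f 2 (volume.restrict (Ω : Set R3))) :
    MemLp (fun x => ℓ x * f x) 2 (volume.restrict (Ω : Set R3)) :=
  memLp_two_mul_bounded hf h.aestronglyMeasurable h.ae_abs_le_one

theorem memLp_sum_partialDeriv (h : IsLengthScale Ω Θ ℓ Cl) {v : R3 → Fin 3 → ℝ}
    (hv : v ∈ L2V Ω) : MemLp (fun x => ∑ j, partialDeriv j ℓ x * v x j) 2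
      (volume.restrict (Ω : Set R3)) :=
  memLp_finsetSum _ fun j _ =>
    memLp_two_mul_bounded (hv j) (aestronglyMeasurable_partialDeriv j _) (h.ae_abs_partialDeriv_le j)

/-- The product rule for the weak divergence. -/
theorem isWeakDiv_mul (h : IsLengthScale Ω Θ ℓ Cl) (hM : M.Resolves Θ)
    (hb : Bornology.IsBounded (Ω : Set R3)) {v : R3 → Fin 3 → ℝ} {d : R3 → ℝ} (hv : v ∈ L2V Ω)
    (hd : MemLp d 2 (volume.restrict (Ω : Set R3))) (hvd : IsWeakDiv Ω v d) :
    IsWeakDiv Ω (fun x j => ℓ x * v x j)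
      (fun x => ℓ x * d x + ∑ j, partialDeriv j ℓ x * v x j) := by
  intro φ
  have := isFiniteMeasure_restrict hb
  obtain ⟨L, hL⟩ := h.exists_lipschitzWith_mul hM φ
  obtain ⟨K, hK⟩ := φ.contDiff.lipschitzWith_of_hasCompactSupport φ.hasCompactSupport (by simp)
  obtain ⟨B, hB⟩ := φ.continuous.bounded_above_of_compact_support φ.hasCompactSupport
  have hφm : AEStronglyMeasurable φ (volume.restrict (Ω : Set R3)) :=
    φ.continuous.aestronglyMeasurable
  -- The divergence of `v` is tested with `ℓ φ`; the term with the derivative of `ℓ` then moves to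
  -- the right-hand side.
  have key := hvd.integral_lipschitz hb hv hd hL φ.hasCompactSupport.mul_left
    ((tsupport_mul_subset_right (f := ℓ) (g := φ)).trans φ.tsupport_subset)
    (G := fun x => ℓ x • fderiv ℝ φ x + φ x • fderiv ℝ ℓ x) (by
      filter_upwards [h.hasStrictFDerivAt hM] with x hx
      exact hx.fun_mul (φ.contDiff.contDiffAt.hasStrictFDerivAt (by simp)))
  have e1 : ∀ x, ∑ j, v x j * (ℓ x • fderiv ℝ φ x + φ x • fderiv ℝ ℓ x)
      (EuclideanSpace.single j 1) = (∑ j, ℓ x * v x j * partialDeriv j φ x)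
        + φ x * ∑ j, partialDeriv j ℓ x * v x j := by
    intro x
    rw [Finset.mul_sum, ← Finset.sum_add_distrib]
    refine Finset.sum_congr rfl fun j _ => ?_
    simp only [add_apply, smul_apply, smul_eq_mul, partialDeriv]
    ring
  have i1 : Integrable (fun x => ∑ j, ℓ x * v x j * partialDeriv j φ x)
      (volume.restrict (Ω : Set R3)) := by
    refine integrable_finsetSum _ fun j _ => ?_
    have hc : Continuous (partialDeriv j φ) :=
      (φ.contDiff.continuous_fderiv (by simp)).clm_apply continuous_const
    have := memLp_two_mul_bounded (h.memLp_mul (hv j)) (g := partialDeriv j φ) (c := K)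
      hc.aestronglyMeasurable (Eventually.of_forall fun x => by
        refine ((fderiv ℝ φ x).le_opNorm _).trans ?_
        simpa using norm_fderiv_le_of_lipschitz ℝ hK (x₀ := x))
    simpa [mul_comm] using this.integrable (by norm_num)
  have i2 : Integrable (fun x => φ x * ∑ j, partialDeriv j ℓ x * v x j)
      (volume.restrict (Ω : Set R3)) :=
    (memLp_two_mul_bounded (h.memLp_sum_partialDeriv hv) hφm
      (Eventually.of_forall hB)).integrable (by norm_num)
  have i3 : Integrable (fun x => φ x * (ℓ x * d x)) (volume.restrict (Ω : Set R3)) :=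
    (memLp_two_mul_bounded (h.memLp_mul hd) hφm (Eventually.of_forall hB)).integrable (by norm_num)
  simp only [e1] at key
  rw [integral_add i1 i2] at key
  have e2 : ∀ x, (ℓ x * d x + ∑ j, partialDeriv j ℓ x * v x j) * φ x
      = φ x * (ℓ x * d x) + φ x * ∑ j, partialDeriv j ℓ x * v x j := fun x => by ring
  have e3 : ∀ x, d x * (ℓ x * φ x) = φ x * (ℓ x * d x) := fun x => by ring
  simp only [e2]
  simp only [e3] at key
  rw [integral_add i3 i2]
  linarith

theorem mul_mem_HDiv (h : IsLengthScale Ω Θ ℓ Cl) (hM : M.Resolves Θ)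
    (hb : Bornology.IsBounded (Ω : Set R3)) {v : R3 → Fin 3 → ℝ} (hv : v ∈ HDiv Ω) :
    (fun x j => ℓ x * v x j) ∈ HDiv Ω := by
  obtain ⟨hv, d, hd, hvd⟩ := hv
  exact ⟨fun j => h.memLp_mul (hv j), _, (h.memLp_mul hd).add (h.memLp_sum_partialDeriv hv),
    h.isWeakDiv_mul hM hb hv hd hvd⟩

end IsLengthScale

/-! ### Discrete spaces -/

theorem weakDiv_spec {Ω : Opens R3} {v : R3 → Fin 3 → ℝ} (hv : v ∈ HDiv Ω) :
    MemLp (weakDiv Ω v) 2 (volume.restrict (Ω : Set R3)) ∧ IsWeakDiv Ω v (weakDiv Ω v) := by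
  unfold weakDiv
  rw [dif_pos hv.2]
  exact hv.2.choose_spec

section

variable {Ω : Opens R3} {M : SimplicialMesh (Ω : Set R3)} {k : ℕ}

/-- A homogeneous polynomial of degree `k` times a coordinate has degree at most `k + 1`. Both
choices of `W` are thus covered by the larger space. -/
theorem RT_subset_BDM : RT k M ⊆ BDM (k + 1) M := by
  rintro v ⟨hv, hdiv⟩
  refine ⟨fun i T hT => ?_, hdiv⟩
  obtain ⟨p, q, hp, hq, h⟩ := hv T hT
  refine ⟨p i + q * .X i, ?_, ?_⟩
  · refine (MvPolynomial.totalDegree_add _ _).trans (max_le ((hp i).trans (Nat.le_succ k)) ?_)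
    refine (MvPolynomial.totalDegree_mul _ _).trans ?_
    rw [MvPolynomial.totalDegree_X]
    exact Nat.add_le_add_right hq.totalDegree_le 1
  · filter_upwards [h] with x hx
    simp [hx i]

theorem exists_polynomial_of_mem_BDM {v : R3 → Fin 3 → ℝ} (hv : v ∈ BDM k M) {t : Finset R3}
    (ht : t ∈ M.tets) : ∃ P : Fin 3 → MvPolynomial (Fin 3) ℝ, (∀ j, (P j).totalDegree ≤ k) ∧
      ∀ᵐ x ∂volume.restrict (openCell t), ∀ j, v x j = evalR3 (P j) x := by
  choose P hP h using fun j => hv.1 j _ (openCell_mem_cells ht)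
  exact ⟨P, hP, ae_all_iff.2 h⟩

theorem totalDegree_sum_pderiv_le {P : Fin 3 → MvPolynomial (Fin 3) ℝ}
    (hP : ∀ j, (P j).totalDegree ≤ k + 1) :
    (∑ j, MvPolynomial.pderiv j (P j)).totalDegree ≤ k :=
  MvPolynomial.totalDegree_finsetSum_le fun j _ => totalDegree_pderiv_le j (hP j)

/-- This makes the divergence of a discrete stress an admissible test function. -/
theorem weakDiv_mem_brokenPoly {v : R3 → Fin 3 → ℝ} (hv : v ∈ BDM (k + 1) M) :
    weakDiv Ω v ∈ brokenPoly k M.cells := by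
  intro T hT
  obtain ⟨t, ht, rfl⟩ := mem_cells.1 hT
  obtain ⟨P, hP, h⟩ := exists_polynomial_of_mem_BDM hv ht
  exact ⟨_, totalDegree_sum_pderiv_le hP, (weakDiv_spec hv.2).2.ae_eq_of_polynomial
    (weakDiv_spec hv.2).1 (isOpen_openCell t) (openCell_subset ht) P h⟩

theorem zero_mem_brokenPoly (𝒯 : Set (Set R3)) : (fun _ => (0 : ℝ)) ∈ brokenPoly k 𝒯 :=
  fun _ _ => ⟨0, by simp, Eventually.of_forall fun _ => by simp⟩

theorem indicator_mem_brokenPoly {q : MvPolynomial (Fin 3) ℝ} (hq : q.totalDegree ≤ k)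
    {t : Finset R3} (ht : t ∈ M.tets) :
    (openCell t).indicator (evalR3 q) ∈ brokenPoly k M.cells := by
  intro T hT
  obtain ⟨s, hs, rfl⟩ := mem_cells.1 hT
  have hmem := ae_restrict_mem (μ := volume) (isOpen_openCell s).measurableSet
  by_cases hst : s = t
  · subst hst
    refine ⟨q, hq, ?_⟩
    filter_upwards [hmem] with x hx
    rw [indicator_of_mem hx]
    rfl
  · refine ⟨0, by simp, ?_⟩
    filter_upwards [hmem] with x hx
    rw [indicator_of_notMem (disjoint_left.1 (disjoint_openCell hs ht hst) hx), map_zero]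

theorem setIntegral_mul_indicator {T : Set R3} (hT : IsOpen T) (hTΩ : T ⊆ Ω) (f g : R3 → ℝ) :
    ∫ x in (Ω : Set R3), f x * T.indicator g x = ∫ x in T, f x * g x := by
  have e : (fun x => f x * T.indicator g x) = T.indicator fun x => f x * g x := by
    ext x
    by_cases hx : x ∈ T <;> simp [hx]
  rw [e, setIntegral_indicator hT.measurableSet, inter_eq_right.2 hTΩ]

/-! ### The kernel of the discrete operator -/

variable {ℓ : R3 → ℝ} {W : Set (R3 → Fin 3 → ℝ)} {p : (R3 → Mat) × (R3 → Mat)}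

theorem innerV_divM_eq_zero (hp : p ∈ discreteKernel ℓ k M W) :
    innerV Ω (divM Ω p.1) (divM Ω p.1) = 0 := by
  -- The test pair is the divergence of `σ` together with zero rotation.
  have hmem : ((divM Ω p.1, fun _ _ => 0) :
      (R3 → Fin 3 → ℝ) × (R3 → Fin 3 → ℝ)) ∈ Xu k M :=
    ⟨fun i => weakDiv_mem_brokenPoly (hp.1.1 i), fun _ => zero_mem_brokenPoly _⟩
  have h := hp.2 _ hmem
  simp only [formS, innerV, opS, Pi.neg_apply, neg_mul, Finset.sum_neg_distrib, integral_neg,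
    mul_zero, Finset.sum_const_zero, integral_zero, add_zero, neg_eq_zero] at h
  exact h

/-- Broken polynomials need no continuity between cells, so a test function may be cut off to one
cell and one component, and the kernel condition localizes. -/
theorem setIntegral_residual_eq_zero (hp : p ∈ discreteKernel ℓ k M W) {t : Finset R3}
    (ht : t ∈ M.tets) (i : Fin 3) {q : MvPolynomial (Fin 3) ℝ} (hq : q.totalDegree ≤ k) :
    ∫ x in openCell t, (asym (p.1 x) i - divM Ω (scale ℓ p.2) x i) * evalR3 q x = 0 := by
  have hmem : ((fun _ _ => 0, fun x => Pi.single i ((openCell t).indicator (evalR3 q) x)) :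
      (R3 → Fin 3 → ℝ) × (R3 → Fin 3 → ℝ)) ∈ Xu k M := by
    refine ⟨fun _ => zero_mem_brokenPoly _, fun j => ?_⟩
    by_cases hij : j = i
    · subst hij
      simpa using indicator_mem_brokenPoly hq ht
    · simpa [hij] using zero_mem_brokenPoly (k := k) M.cells
  have h := hp.2 _ hmem
  simp only [formS, innerV, mul_zero, Finset.sum_const_zero, integral_zero, zero_add] at h
  rw [← setIntegral_mul_indicator (isOpen_openCell t) (openCell_subset ht), ← h]
  refine integral_congr_ae (Eventually.of_forall fun x => ?_)
  simp only
  rw [Finset.sum_eq_single i (fun j _ hj => by simp [hj]) (by simp)]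
  simp [opS]

end

/-! ### The divergence estimate on a cell and its summation -/

/-- An element of a weighted projection problem is controlled by its data. -/
theorem setIntegral_mul_sq_le {T : Set R3} (hT : MeasurableSet T) {l q g : R3 → ℝ} {m C : ℝ}
    (hm : 0 ≤ m) (hl : ∀ x ∈ T, 0 ≤ l x ∧ l x ≤ m) (hlm : Measurable l)
    (hq : MemLp q 2 (volume.restrict T)) (hg : MemLp g 2 (volume.restrict T))
    (hlow : m * ∫ x in T, q x ^ 2 ≤ C * ∫ x in T, l x * q x ^ 2)
    (horth : ∫ x in T, l x * q x ^ 2 = ∫ x in T, g x * q x) :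
    ∫ x in T, (l x * q x) ^ 2 ≤ C ^ 2 * ∫ x in T, g x ^ 2 := by
  have iq := hq.integrable_sq
  have ig := hg.integrable_sq
  have igq : Integrable (fun x => g x * q x) (volume.restrict T) := hg.integrable_mul hq
  have ilq : Integrable (fun x => (l x * q x) ^ 2) (volume.restrict T) :=
    (memLp_two_mul_bounded hq hlm.aestronglyMeasurable (c := m)
      ((ae_restrict_iff' hT).2 (Eventually.of_forall fun x hx => by
        rw [abs_of_nonneg (hl x hx).1]
        exact (hl x hx).2))).integrable_sq
  have h1 : ∫ x in T, (l x * q x) ^ 2 ≤ m ^ 2 * ∫ x in T, q x ^ 2 := by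
    rw [← integral_const_mul]
    refine setIntegral_mono_on ilq (iq.const_mul _) hT fun x hx => ?_
    rw [mul_pow]
    exact mul_le_mul_of_nonneg_right (pow_le_pow_left₀ (hl x hx).1 (hl x hx).2 2) (sq_nonneg _)
  -- Young's inequality, weighted so that half of `m ^ 2 * ∫ q ^ 2` is absorbed. There is no
  -- division by `m`, so `m = 0` is allowed.
  have h2 : (C * m) * ∫ x in T, g x * q x
      ≤ C ^ 2 / 2 * (∫ x in T, g x ^ 2) + m ^ 2 / 2 * ∫ x in T, q x ^ 2 := by
    rw [← integral_const_mul, ← integral_const_mul, ← integral_const_mul,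
      ← integral_add (ig.const_mul _) (iq.const_mul _)]
    refine integral_mono (igq.const_mul _) ((ig.const_mul _).add (iq.const_mul _)) fun x => ?_
    simp only
    nlinarith [sq_nonneg (C * g x - m * q x)]
  rw [horth] at hlow
  have h3 := mul_le_mul_of_nonneg_left hlow hm
  linarith

theorem sq_add_le (a b : ℝ) : (a + b) ^ 2 ≤ 2 * a ^ 2 + 2 * b ^ 2 := by
  nlinarith [sq_nonneg (a - b)]

/-- The squared Frobenius norm of a matrix. -/
def frobSq (m : Mat) : ℝ := ∑ i, ∑ j, m i j * m i j

theorem sum_asym_sq_le (m : Mat) : ∑ i, asym m i ^ 2 ≤ 2 * frobSq m := by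
  have h : ∀ a b : ℝ, (a - b) ^ 2 ≤ 2 * (a * a) + 2 * (b * b) := fun a b => by
    nlinarith [sq_nonneg (a + b)]
  simp only [frobSq, asym, Fin.sum_univ_three]
  have e1 : (0 - 1 : Fin 3) = 2 := rfl
  have e2 : (1 - 1 : Fin 3) = 0 := rfl
  have e3 : (2 - 1 : Fin 3) = 1 := rfl
  have e4 : (0 + 1 : Fin 3) = 1 := rfl
  have e5 : (1 + 1 : Fin 3) = 2 := rfl
  have e6 : (2 + 1 : Fin 3) = 0 := rfl
  rw [e1, e2, e3, e4, e5, e6]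
  linarith [h (m 2 1) (m 1 2), h (m 0 2) (m 2 0), h (m 1 0) (m 0 1), mul_self_nonneg (m 0 0),
    mul_self_nonneg (m 1 1), mul_self_nonneg (m 2 2)]

theorem integrable_frobSq {Ω : Set R3} {σ : R3 → Mat} (hσ : σ ∈ L2M Ω) :
    Integrable (fun x => frobSq (σ x)) (volume.restrict Ω) :=
  integrable_finsetSum _ fun i _ => integrable_finsetSum _ fun j _ =>
    (hσ i j).integrable_mul (hσ i j)

theorem innerM_self_eq (Ω : Set R3) (σ : R3 → Mat) :
    innerM Ω σ σ = ∫ x in Ω, frobSq (σ x) := rfl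

/-- The Cauchy-Schwarz inequality for directional derivatives of an affine function. -/
theorem sq_sum_pderiv_mul_le {l : MvPolynomial (Fin 3) ℝ} {Cl : ℝ}
    (hn : ‖fderiv ℝ (evalR3 l) 0‖ ≤ Cl) (w : Fin 3 → ℝ) :
    (∑ j, evalR3 (MvPolynomial.pderiv j l) 0 * w j) ^ 2 ≤ Cl ^ 2 * ∑ j, w j * w j := by
  have e : ∑ j, evalR3 (MvPolynomial.pderiv j l) 0 * w j
      = fderiv ℝ (evalR3 l) 0 (WithLp.toLp 2 w) := by
    have hw : (WithLp.toLp 2 w : R3) = ∑ j, w j • EuclideanSpace.single j (1 : ℝ) := by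
      simpa using ((EuclideanSpace.basisFun (Fin 3) ℝ).sum_repr (WithLp.toLp 2 w)).symm
    rw [hw, map_sum]
    refine Finset.sum_congr rfl fun j _ => ?_
    rw [map_smul, smul_eq_mul, mul_comm, ← partialDeriv_evalR3]
    rfl
  have hnorm : ‖(WithLp.toLp 2 w : R3)‖ ^ 2 = ∑ j, w j * w j := by
    rw [EuclideanSpace.norm_sq_eq]
    exact Finset.sum_congr rfl fun j _ => by rw [Real.norm_eq_abs, sq_abs, sq]
  rw [e, ← hnorm, ← mul_pow, ← sq_abs]
  exact pow_le_pow_left₀ (abs_nonneg _) (((fderiv ℝ (evalR3 l) 0).le_opNorm _).trans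
    (mul_le_mul_of_nonneg_right hn (norm_nonneg _))) 2

theorem asym_memLp {Ω : Set R3} {σ : R3 → Mat} (hσ : σ ∈ L2M Ω) (i : Fin 3) :
    MemLp (fun x => asym (σ x) i) 2 (volume.restrict Ω) :=
  (hσ (i - 1) (i + 1)).sub (hσ (i + 1) (i - 1))

/-- On each cell, the weighted divergence of an element of the discrete kernel is bounded by the
element itself, with a constant that only depends on the degree and the slope of the length
scale. -/
theorem exists_cell_bound (k : ℕ) (Cl : ℝ) : ∃ K : ℝ, 0 < K ∧
    ∀ (Ω : Opens R3), Bornology.IsBounded (Ω : Set R3) →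
    ∀ (Θ : Set (Set R3)) (ℓ : R3 → ℝ), IsLengthScale Ω Θ ℓ Cl →
    ∀ M : SimplicialMesh (Ω : Set R3), M.Resolves Θ →
    ∀ p ∈ discreteKernel ℓ k M (BDM (k + 1) M), ∀ t ∈ M.tets, ∀ i,
      ∫ x in openCell t, divM Ω (scale ℓ p.2) x i ^ 2 ≤
        K * ∫ x in openCell t, (asym (p.1 x) i ^ 2 + ∑ j, p.2 x i j * p.2 x i j) := by
  obtain ⟨C, hC, hbound⟩ := exists_simplex_bound k
  -- From `2 C² (s - β)² + 2 β² ≤ 4 C² s² + (4 C² + 2) β²` and `β² ≤ Cl² |ω_i|²`, with `ω_i` the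
  -- row.
  refine ⟨4 * C ^ 2 + (4 * C ^ 2 + 2) * Cl ^ 2, by positivity, ?_⟩
  intro Ω hb Θ ℓ hℓ M hM p hp t ht i
  set T := openCell t with hTdef
  have hT : IsOpen T := isOpen_openCell t
  have hTΩ : T ⊆ Ω := openCell_subset ht
  have hTb : Bornology.IsBounded T := isBounded_openCell t
  have hmono : volume.restrict T ≤ volume.restrict (Ω : Set R3) :=
    Measure.restrict_mono hTΩ le_rfl
  have hmem := ae_restrict_mem (μ := volume) hT.measurableSet
  obtain ⟨l, hl, hℓl, hn⟩ := hℓ.exists_affine hM ht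
  have hℓT : ∀ x ∈ T, ℓ x = evalR3 l x := fun x hx => hℓl ⟨interior_subset hx, hTΩ hx⟩
  have hω : (fun x => p.2 x i) ∈ BDM (k + 1) M := hp.1.2 i
  have hsc : (fun x => scale ℓ p.2 x i) ∈ HDiv Ω := hℓ.mul_mem_HDiv hM hb hω.2
  have hσ : p.1 ∈ L2M Ω := fun i j => (hp.1.1 i).2.1 j
  obtain ⟨P, hP, hPω⟩ := exists_polynomial_of_mem_BDM hω ht
  set q := ∑ j, MvPolynomial.pderiv j (P j) with hqdef
  have hq : q.totalDegree ≤ k := totalDegree_sum_pderiv_le hP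
  set β : R3 → ℝ := fun x => ∑ j, evalR3 (MvPolynomial.pderiv j l) 0 * p.2 x i j with hβ
  set s : R3 → ℝ := fun x => asym (p.1 x) i with hs
  -- On the cell the chosen weak divergence of `ℓω` is the classical one of `l * P j`, which the
  -- Leibniz rule splits.
  have hD : ∀ᵐ x ∂volume.restrict T,
      divM Ω (scale ℓ p.2) x i = evalR3 l x * evalR3 q x + β x := by
    have h := (weakDiv_spec hsc).2.ae_eq_of_polynomial (weakDiv_spec hsc).1 hT hTΩ
      (fun j => l * P j) (by
        filter_upwards [hPω, hmem] with x hx hxT j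
        rw [evalR3_mul, ← hx j, ← hℓT x hxT]
        rfl)
    filter_upwards [h, hPω] with x hx hxP
    refine hx.trans ?_
    simp only [hβ, hqdef, evalR3_sum, Finset.mul_sum, ← Finset.sum_add_distrib]
    refine Finset.sum_congr rfl fun j _ => ?_
    rw [Derivation.leibniz, evalR3_add, smul_eq_mul, smul_eq_mul, evalR3_mul, evalR3_mul, hxP j,
      evalR3_pderiv_const hl j x 0]
    ring
  have hωT : ∀ j, MemLp (fun x => p.2 x i j) 2 (volume.restrict T) := fun j =>
    (hω.2.1 j).mono_measure hmono
  have hβm : MemLp β 2 (volume.restrict T) := memLp_finsetSum _ fun j _ => (hωT j).const_mul _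
  have hsm : MemLp s 2 (volume.restrict T) := (asym_memLp hσ i).mono_measure hmono
  have hqm : MemLp (evalR3 q) 2 (volume.restrict T) := memLp_evalR3 q hTb hT.measurableSet
  have hlqm : MemLp (fun x => evalR3 l x * evalR3 q x) 2 (volume.restrict T) := by
    have := memLp_evalR3 (l * q) hTb hT.measurableSet
    simpa only [evalR3_mul] using (memLp_congr_ae (Eventually.of_forall fun x =>
      evalR3_mul l q x)).1 this
  -- The test function is `q`, the unweighted divergence of the row, whose degree is at most `k`.
  have horth : ∫ x in T, evalR3 l x * evalR3 q x ^ 2 = ∫ x in T, (s x - β x) * evalR3 q x := by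
    have h0 := setIntegral_residual_eq_zero hp ht i hq
    have i1 : Integrable (fun x => (s x - β x) * evalR3 q x) (volume.restrict T) :=
      (hsm.sub hβm).integrable_mul hqm
    have i2 : Integrable (fun x => evalR3 l x * evalR3 q x ^ 2) (volume.restrict T) := by
      have : Integrable (fun x => (evalR3 l x * evalR3 q x) * evalR3 q x) (volume.restrict T) :=
        hlqm.integrable_mul hqm
      refine this.congr (Eventually.of_forall fun x => ?_)
      simp only
      ring
    have e : ∫ x in T, (asym (p.1 x) i - divM Ω (scale ℓ p.2) x i) * evalR3 q x
        = ∫ x in T, ((s x - β x) * evalR3 q x - evalR3 l x * evalR3 q x ^ 2) := by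
      refine integral_congr_ae ?_
      filter_upwards [hD] with x hx
      rw [hx]
      ring
    rw [e, integral_sub i1 i2] at h0
    linarith
  obtain ⟨v, hv, hr⟩ := exists_vertices ht
  have hrT : interior (convexHull ℝ (range v)) = T := by rw [hr]; rfl
  have hpos : ∀ x ∈ T, 0 ≤ evalR3 l x := fun x hx => by
    rw [← hℓT x hx]
    exact (hℓ.mem_Icc (hTΩ hx)).1
  obtain ⟨m, hm, hlm, hlow⟩ := hbound v hv q l hq hl (by rwa [hrT])
  rw [hrT] at hlm hlow
  have hmain := setIntegral_mul_sq_le hT.measurableSet hm (fun x hx => ⟨hpos x hx, hlm x hx⟩)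
    (continuous_evalR3 l).measurable hqm (hsm.sub hβm) hlow horth
  have iw : Integrable (fun x => ∑ j, p.2 x i j * p.2 x i j) (volume.restrict T) :=
    integrable_finsetSum _ fun j _ => (hωT j).integrable_mul (hωT j)
  have is := hsm.integrable_sq
  have iβ := hβm.integrable_sq
  calc ∫ x in T, divM Ω (scale ℓ p.2) x i ^ 2
      = ∫ x in T, (evalR3 l x * evalR3 q x + β x) ^ 2 := by
        refine integral_congr_ae ?_
        filter_upwards [hD] with x hx
        rw [hx]
    _ ≤ ∫ x in T, (2 * (evalR3 l x * evalR3 q x) ^ 2 + 2 * β x ^ 2) :=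
        integral_mono (hlqm.add hβm).integrable_sq
          ((hlqm.integrable_sq.const_mul 2).add (iβ.const_mul 2)) fun x => sq_add_le _ _
    _ = 2 * (∫ x in T, (evalR3 l x * evalR3 q x) ^ 2) + ∫ x in T, 2 * β x ^ 2 := by
        rw [integral_add (hlqm.integrable_sq.const_mul 2) (iβ.const_mul 2), integral_const_mul]
    _ ≤ 2 * (C ^ 2 * ∫ x in T, (s x - β x) ^ 2) + ∫ x in T, 2 * β x ^ 2 := by
        simp only [Pi.sub_apply] at hmain
        linarith
    _ = ∫ x in T, (2 * C ^ 2 * (s x - β x) ^ 2 + 2 * β x ^ 2) := by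
        have isb : Integrable (fun x => (s x - β x) ^ 2) (volume.restrict T) :=
          (hsm.sub hβm).integrable_sq
        rw [integral_add (isb.const_mul _) (iβ.const_mul 2), integral_const_mul (2 * C ^ 2), mul_assoc]
    _ ≤ ∫ x in T, (4 * C ^ 2 + (4 * C ^ 2 + 2) * Cl ^ 2)
          * (s x ^ 2 + ∑ j, p.2 x i j * p.2 x i j) := by
        have isb : Integrable (fun x => (s x - β x) ^ 2) (volume.restrict T) :=
          (hsm.sub hβm).integrable_sq
        refine integral_mono ((isb.const_mul _).add (iβ.const_mul 2))
          ((is.add iw).const_mul _) fun x => ?_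
        have h1 := sq_add_le (s x) (-β x)
        have h2 : β x ^ 2 ≤ Cl ^ 2 * ∑ j, p.2 x i j * p.2 x i j := sq_sum_pderiv_mul_le hn _
        have h3 : 0 ≤ ∑ j, p.2 x i j * p.2 x i j :=
          Finset.sum_nonneg fun j _ => mul_self_nonneg _
        have h4 := mul_le_mul_of_nonneg_left h1 (by positivity : 0 ≤ 2 * C ^ 2)
        have h5 := mul_le_mul_of_nonneg_left h2 (by positivity : 0 ≤ 4 * C ^ 2 + 2)
        have h6 : 0 ≤ C ^ 2 * ∑ j, p.2 x i j * p.2 x i j := by positivity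
        have h7 : 0 ≤ (4 * C ^ 2 + 2) * Cl ^ 2 * s x ^ 2 := by positivity
        simp only
        rw [← sub_eq_add_neg] at h4
        linarith
    _ = _ := integral_const_mul _ _

/-- The weighted divergence of an element of the discrete kernel is bounded by the element. -/
theorem exists_divergence_bound (k : ℕ) (Cl : ℝ) : ∃ K : ℝ, 0 < K ∧
    ∀ (Ω : Opens R3), Bornology.IsBounded (Ω : Set R3) →
    ∀ (Θ : Set (Set R3)) (ℓ : R3 → ℝ), IsLengthScale Ω Θ ℓ Cl →
    ∀ M : SimplicialMesh (Ω : Set R3), M.Resolves Θ →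
    ∀ p ∈ discreteKernel ℓ k M (BDM (k + 1) M),
      innerV Ω (divM Ω (scale ℓ p.2)) (divM Ω (scale ℓ p.2)) ≤
        K * (innerM Ω p.1 p.1 + innerM Ω p.2 p.2) := by
  obtain ⟨K, hK, h⟩ := exists_cell_bound k Cl
  -- The factor `2` comes from the bound of `Sσ` by the Frobenius norm of `σ`.
  refine ⟨2 * K, by positivity, fun Ω hb Θ ℓ hℓ M hM p hp => ?_⟩
  have hσ : p.1 ∈ L2M Ω := fun i j => (hp.1.1 i).2.1 j
  have hω : p.2 ∈ L2M Ω := fun i j => (hp.1.2 i).2.1 j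
  have hsc : ∀ i, (fun x => scale ℓ p.2 x i) ∈ HDiv Ω := fun i =>
    hℓ.mul_mem_HDiv hM hb (hp.1.2 i).2
  have iD : ∀ i, Integrable (fun x => divM Ω (scale ℓ p.2) x i ^ 2)
      (volume.restrict (Ω : Set R3)) := fun i => (weakDiv_spec (hsc i)).1.integrable_sq
  have iR : ∀ i, Integrable (fun x => asym (p.1 x) i ^ 2 + ∑ j, p.2 x i j * p.2 x i j)
      (volume.restrict (Ω : Set R3)) := fun i =>
    (asym_memLp hσ i).integrable_sq.add
      (integrable_finsetSum _ fun j _ => (hω i j).integrable_mul (hω i j))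
  have hrow : ∀ i, ∫ x in (Ω : Set R3), divM Ω (scale ℓ p.2) x i ^ 2 ≤
      K * ∫ x in (Ω : Set R3), (asym (p.1 x) i ^ 2 + ∑ j, p.2 x i j * p.2 x i j) := by
    intro i
    rw [M.setIntegral_eq_sum (iD i), M.setIntegral_eq_sum (iR i), Finset.mul_sum]
    exact Finset.sum_le_sum fun t ht => h Ω hb Θ ℓ hℓ M hM p hp t ht i
  calc innerV Ω (divM Ω (scale ℓ p.2)) (divM Ω (scale ℓ p.2))
      = ∑ i, ∫ x in (Ω : Set R3), divM Ω (scale ℓ p.2) x i ^ 2 := by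
        rw [← integral_finsetSum _ fun i _ => iD i]
        simp only [innerV, sq]
    _ ≤ ∑ i, K * ∫ x in (Ω : Set R3), (asym (p.1 x) i ^ 2 + ∑ j, p.2 x i j * p.2 x i j) :=
        Finset.sum_le_sum fun i _ => hrow i
    _ = K * ∫ x in (Ω : Set R3), ((∑ i, asym (p.1 x) i ^ 2) + frobSq (p.2 x)) := by
        rw [← Finset.mul_sum, ← integral_finsetSum _ fun i _ => iR i]
        simp only [Finset.sum_add_distrib, frobSq]
    _ ≤ K * ∫ x in (Ω : Set R3), (2 * frobSq (p.1 x) + 2 * frobSq (p.2 x)) := by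
        refine mul_le_mul_of_nonneg_left (integral_mono ?_ ?_ fun x => ?_) hK.le
        · exact (integrable_finsetSum _ fun i _ => (asym_memLp hσ i).integrable_sq).add
            (integrable_frobSq hω)
        · exact ((integrable_frobSq hσ).const_mul 2).add ((integrable_frobSq hω).const_mul 2)
        · have h1 := sum_asym_sq_le (p.1 x)
          have h2 : 0 ≤ frobSq (p.2 x) := Finset.sum_nonneg fun i _ =>
            Finset.sum_nonneg fun j _ => mul_self_nonneg _
          simp only
          linarith
    _ = 2 * K * (innerM Ω p.1 p.1 + innerM Ω p.2 p.2) := by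
        rw [integral_add ((integrable_frobSq hσ).const_mul 2) ((integrable_frobSq hω).const_mul 2),
          integral_const_mul, integral_const_mul, innerM_self_eq, innerM_self_eq]
        ring

theorem innerM_self_nonneg (Ω : Set R3) (σ : R3 → Mat) : 0 ≤ innerM Ω σ σ :=
  integral_nonneg fun _ => Finset.sum_nonneg fun _ _ =>
    Finset.sum_nonneg fun _ _ => mul_self_nonneg _

end Cosserat
end

theorem lemma4p6 (k : ℕ) (Cl : ℝ) :
    ∃ C : ℝ, 0 < C ∧
      ∀ (Ω : TopologicalSpace.Opens Cosserat.R3),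
        Bornology.IsBounded (Ω : Set Cosserat.R3) → ContractibleSpace Ω →
      ∀ (Aσ Aω : Cosserat.FourTensorField) (aσ bσ aω bω : ℝ),
        Cosserat.IsMaterialTensor Ω Aσ aσ bσ → Cosserat.IsMaterialTensor Ω Aω aω bω →
      ∀ (Θ : Set (Set Cosserat.R3)) (ℓ : Cosserat.R3 → ℝ),
        Cosserat.IsPartition Ω Θ → Cosserat.IsLengthScale Ω Θ ℓ Cl →
      ∀ M : Cosserat.SimplicialMesh (Ω : Set Cosserat.R3), M.Resolves Θ →
      ∀ W : Set (Cosserat.R3 → Fin 3 → ℝ),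
        (W = Cosserat.BDM (k + 1) M ∨ W = Cosserat.RT k M) →
        Cosserat.Xp k M W ⊆ Cosserat.HlM Ω ℓ ∧
        Cosserat.Xu k M ⊆ Cosserat.L2V Ω ×ˢ Cosserat.L2V Ω ∧
        ∀ p ∈ Cosserat.discreteKernel ℓ k M W,
          C * min aσ aω * Cosserat.normSqHlM Ω ℓ p ≤ Cosserat.formA Ω Aσ Aω p p := by
  obtain ⟨K, hK, hbound⟩ := Cosserat.exists_divergence_bound k Cl
  -- On the kernel the squared norm is at most `1 + K` times `‖σ‖² + ‖ω‖²`.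
  refine ⟨1 / (1 + K), by positivity, ?_⟩
  intro Ω hb _ Aσ Aω aσ bσ aω bω hσ hω Θ ℓ _ hℓ M hM W hW
  have hsub : W ⊆ Cosserat.BDM (k + 1) M := by
    rcases hW with rfl | rfl
    · exact subset_rfl
    · exact Cosserat.RT_subset_BDM
  refine ⟨?_, ?_, ?_⟩
  · rintro p ⟨hp1, hp2⟩
    exact ⟨fun i => (hp1 i).2, fun i j => (hsub (hp2 i)).2.1 j,
      fun i => hℓ.mul_mem_HDiv hM hb (hsub (hp2 i)).2⟩
  · rintro u ⟨hu1, hu2⟩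
    exact ⟨fun i => Cosserat.memLp_of_mem_brokenPoly (hu1 i),
      fun i => Cosserat.memLp_of_mem_brokenPoly (hu2 i)⟩
  · intro p hp
    -- The test space does not depend on `W`, so the kernel for the smaller stress space lies in the
    -- one for BDM.
    have hp' : p ∈ Cosserat.discreteKernel ℓ k M (Cosserat.BDM (k + 1) M) :=
      ⟨⟨hp.1.1, fun i => hsub (hp.1.2 i)⟩, hp.2⟩
    have h0 := Cosserat.innerV_divM_eq_zero hp'
    have h1 := hbound Ω hb Θ ℓ hℓ M hM p hp'
    have h2 := hσ.lower p.1 fun i j => (hp'.1.1 i).2.1 j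
    have h3 := hω.lower p.2 fun i j => (hp'.1.2 i).2.1 j
    have n1 := Cosserat.innerM_self_nonneg Ω p.1
    have n2 := Cosserat.innerM_self_nonneg Ω p.2
    have hmin : 0 < min aσ aω := lt_min hσ.lo_pos hω.lo_pos
    have h4 := mul_le_mul_of_nonneg_right (min_le_left aσ aω) n1
    have h5 := mul_le_mul_of_nonneg_right (min_le_right aσ aω) n2
    have hnorm : Cosserat.normSqHlM Ω ℓ p ≤
        (1 + K) * (Cosserat.innerM Ω p.1 p.1 + Cosserat.innerM Ω p.2 p.2) := by
      simp only [Cosserat.normSqHlM, h0]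
      linarith
    calc 1 / (1 + K) * min aσ aω * Cosserat.normSqHlM Ω ℓ p
        ≤ 1 / (1 + K) * min aσ aω *
          ((1 + K) * (Cosserat.innerM Ω p.1 p.1 + Cosserat.innerM Ω p.2 p.2)) :=
          mul_le_mul_of_nonneg_left hnorm (by positivity)
      _ = min aσ aω * (Cosserat.innerM Ω p.1 p.1 + Cosserat.innerM Ω p.2 p.2) := by
          field_simp
      _ ≤ Cosserat.formA Ω Aσ Aω p p := by
          simp only [Cosserat.formA]
          linarith
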